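/- Let $H\ge 0$ and let $A=\{a_n\}$ be a locally finite multiset (each point has a finite multiplicity) contained in the closed strip $S_H=\{z\in\mathbb C:|\operatorname{Im} z|\le H\}$, and put $\mu_A=\sum_n\delta_{a_n}$, points being counted with multiplicity. Assume that $A$ is almost periodic, i.e. for every continuous compactly supported $\varphi:\mathbb C\to\mathbb C$ the function $g(z)=\int\varphi(z-w)\,\mu_A(dw)$ is almost periodic on $\mathbb C$: it is continuous, and for all real $\alpha<\beta$ and every $\varepsilon>0$ there is $L>0$ such that every interval $(t,t+L)$, $t\in\mathbb R$, contains a $\tau$ with $\sup_{\alpha\le\operatorname{Im}z\le\beta}|g(z+\tau)-g(z)|<\varepsilon$. For $\varphi\in C_c^\infty(\mathbb R)$ let $\hat\varphi^c(z)=\int_{\mathbb R}\varphi(t)e^{-2\pi i zt}\,dt$, $z\in\mathbb C$. Suppose that the c-Fourier transform $\hat\mu_A^c$ of $\mu_A$, which is the distribution on $\mathbb R$ defined by $(\hat\mu_A^c,\varphi)=\int\hat\varphi^c(z)\,\mu_A(dz)$, is a pure point measure $$\hat\mu_A^c=\sum_{\gamma\in\Gamma}b_\gamma\delta_\gamma,\qquad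 \Gamma=\{\gamma\in\mathbb R:b_\gamma\ne0\},$$ where $\Gamma$ is countable and $\sum_{|\gamma|<r}|b_\gamma|<\infty$ for every $r>0$, and that $$\log\sum_{|\gamma|<r}|b_\gamma|=O(r)\quad(r\to\infty)\qquad\text{and}\qquad\sum_{0<|\gamma|<1}\left|\frac{b_\gamma}{\gamma}\right|<\infty$$ (the first condition being regarded as satisfied if all $b_\gamma$ vanish). Then there is a Dirichlet series $$Q(z)=\sum_{\omega\in\Omega}q_\omega e^{2\pi i\omega z},\qquad q_\omega\in\mathbb C,\quad\sum_{\omega\in\Omega}|q_\omega|<\infty,\quad\Omega\subset\mathbb R\ \text{bounded},$$ whose zero set, with multiplicities, is $A$. If, in addition, $\Gamma$ is locally finite (its intersection with every compact set is finite), then $Q$ is an exponential polynomial, i.e. only finitely many of the $q_\omega$ are nonzero. -/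

import Mathlib

open Filter Asymptotics MeasureTheory Complex
open scoped ContDiff ENNReal

noncomputable section

/-- A set in a topological space is locally finite if it meets every compact set in a finite set. -/
def LocFiniteSet {X : Type*} [TopologicalSpace X] (S : Set X) : Prop :=
  ∀ K : Set X, IsCompact K → (K ∩ S).Finite

/-- A multiset of complex numbers with finite multiplicities is given by its multiplicity function
`A : ℂ → ℕ` (`A z = 0` if `z` does not occur). This says that it is locally finite and
contained in the closed strip `|Im z| ≤ H`. -/
structure IsStripMultiset (H : ℝ) (A : ℂ → ℕ) : Prop where
  abs_im_le : ∀ z : ℂ, A z ≠ 0 → |z.im| ≤ H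
  locFinite : LocFiniteSet (Function.support A)

/-- The measure `μ_A = ∑ₙ δ_{aₙ}`: a unit mass at each point of the multiset `A`,
points being counted with their multiplicities. -/
def countingMeasure (A : ℂ → ℕ) : Measure ℂ :=
  Measure.sum fun z : ℂ => (A z : ℝ≥0∞) • Measure.dirac z

/-- A set of real numbers is relatively dense if it meets every interval `(t, t + L)`
for a suitable length `L`. -/
def RelativelyDense (E : Set ℝ) : Prop :=
  ∃ L : ℝ, ∀ t : ℝ, (E ∩ Set.Ioo t (t + L)).Nonempty

/-- (Bohr) almost periodic functions on the strip `-∞ < Im z < +∞`, that is, on `ℂ`: continuous, and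
on every closed strip `a ≤ Im z ≤ b` the `ε`-almost periods are relatively dense. -/
structure AlmostPeriodicFun (g : ℂ → ℂ) : Prop where
  continuous : Continuous g
  relDense : ∀ a b ε : ℝ, a < b → 0 < ε →
    RelativelyDense {τ : ℝ | ∀ z : ℂ, a ≤ z.im → z.im ≤ b → ‖g (z + τ) - g z‖ < ε}

/-- A measure on `ℂ` (carried by a closed horizontal strip of finite width) is almost periodic if
its convolution with every compactly supported continuous function is an almost periodic function
on `ℂ`. -/
def AlmostPeriodicMeasure (μ : Measure ℂ) : Prop :=
  ∀ φ : ℂ → ℂ, Continuous φ → HasCompactSupport φ →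
    AlmostPeriodicFun fun z => ∫ w, φ (z - w) ∂μ

/-- The function `z ↦ ∫ φ(t) e^{-2πizt} dt`, the extension of the Fourier transform to the complex
plane. -/
def cFourierFun (φ : ℝ → ℂ) (z : ℂ) : ℂ :=
  ∫ t : ℝ, φ t * cexp (-2 * Real.pi * I * z * t)

/-- The value of the c-Fourier transform of the measure `μ` on the test function `φ`. -/
def cFourier (μ : Measure ℂ) (φ : ℝ → ℂ) : ℂ :=
  ∫ z, cFourierFun φ z ∂μ

/-- The c-Fourier transform of `μ` is the pure point measure `∑ b_γ δ_γ` on the real line: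
the sum `∑ b_γ δ_γ` has locally finite total variation, and it acts on
the compactly supported smooth functions as the c-Fourier transform of `μ` does. -/
structure CFourierIsPurePoint (μ : Measure ℂ) (b : ℝ → ℂ) : Prop where
  locSummable : ∀ r : ℝ, Summable fun γ : {γ : ℝ // |γ| < r} => ‖b γ‖
  hasSum : ∀ φ : ℝ → ℂ, ContDiff ℝ ∞ φ → HasCompactSupport φ →
    HasSum (fun γ : ℝ => b γ * φ γ) (cFourier μ φ)

/-- The Dirichlet series `∑ q_s e^{2πisz}` with coefficients `q : ℝ → ℂ`. -/
def dirichletSeries (q : ℝ → ℂ) (z : ℂ) : ℂ :=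
  ∑' s : ℝ, q s * cexp (2 * Real.pi * I * s * z)

/-- The zero set of `f`, with multiplicities, is the multiset `A`
(in particular, `f` does not vanish identically near any point). -/
def HasZeroSet (f : ℂ → ℂ) (A : ℂ → ℕ) : Prop :=
  ∀ z : ℂ, AnalyticAt ℂ f z ∧ analyticOrderAt f z = A z

end

noncomputable section

/-! Almost periodicity bounds the number of points of `A` per unit length of the strip, so the
genus-one canonical product `f` over `A`, based at a point `p` outside the strip, converges. It
remains to find a linear exponential `e^{lz}` that turns `f` into a Dirichlet series with bounded
spectrum.

The Fourier hypothesis controls `(log f)'' = -∑ (z - a)⁻²`. Since `(z - a)⁻²` is, up to `-4π²`, the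
c-Fourier transform at `a` of `max t 0 · e^{2πitz}`, testing against smooth truncations of that
function gives `∑ (z - a)⁻² = -4π² ∑_{γ>0} γ b_γ e^{2πiγz}` high in the upper half-plane
(`tsum_inv_sq_eq`). The exponential bound on the masses of `b` makes the right side converge there.
Two integrations give `f = c₀ e^{c₁z} exp(-∑_{γ>0} (b_γ/γ) e^{2πiγz})`, where the condition on
`b_γ/γ` near `0` is what makes the exponent summable; exponentiating in a weighted ℓ¹ convolution
algebra yields a Dirichlet series with frequencies bounded below. Reflection treats the lower
half-plane, with constants `d₀`, `d₁` (`canonicalProduct_eq_exp`, `exists_dirichletSeries_eq`).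

The two expansions are then glued. Cancellation between `z` and `-z` in `f'/f` shows `Re (c₁ + d₁) =
0` (`tendsto_re_logDeriv_canonicalProduct_sub`), so a suitable `F = f e^{lz}` has frequencies `≥ ν`
above and `≤ -ν` below, with `ν` real. `F` is bounded on two horizontal lines and has order at most
two, hence is bounded between them by Phragmén–Lindelöf. Cauchy's theorem on long rectangles then
makes the Bohr means on both lines agree (`coeff_eq_of_bounded_on_strip`). So both series have the
same coefficients, supported in `[ν, -ν]`, and `F` is their sum everywhere.

If `Γ` is locally finite, the frequencies lie in `ν` plus the semigroup generated by the positive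
part of `Γ`; this semigroup is locally finite, so a bounded spectrum is finite. -/

/-! ### Density of the points of an almost periodic multiset. -/

theorem summable_of_sum_fiber_le {ι κ : Type*} {f : ι → ℝ} (hf : ∀ i, 0 ≤ f i) (n : ι → κ)
    {u : κ → ℝ} (hu : Summable u)
    (h : ∀ k, ∀ s : Finset ι, (∀ i ∈ s, n i = k) → ∑ i ∈ s, f i ≤ u k) : Summable f := by
  classical
  have hu0 : ∀ k, 0 ≤ u k := fun k => by simpa using h k ∅ (by simp)
  refine summable_of_sum_le hf (c := ∑' k, u k) fun s => ?_
  rw [← Finset.sum_fiberwise_of_maps_to (t := s.image n) (g := n)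
    (fun i hi => Finset.mem_image_of_mem n hi)]
  refine (Finset.sum_le_sum fun k _ => h k _ fun i hi => (Finset.mem_filter.1 hi).2).trans ?_
  exact hu.sum_le_tsum _ fun k _ => hu0 k

/-- Indexing by `Σ z, Fin (A z)` lists each point as often as its multiplicity, so later sums and
products over `A` carry no explicit weights. -/
theorem countingMeasure_eq_sum_dirac (A : ℂ → ℕ) :
    countingMeasure A = Measure.sum fun i : Σ z : ℂ, Fin (A z) => Measure.dirac i.1 := by
  ext s hs
  rw [countingMeasure, Measure.sum_apply _ hs, Measure.sum_apply _ hs, ENNReal.tsum_sigma']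
  refine tsum_congr fun z => ?_
  simp

theorem finite_index_of_isCompact {A : ℂ → ℕ} (hA : LocFiniteSet (Function.support A)) {K : Set ℂ}
    (hK : IsCompact K) : {i : Σ z : ℂ, Fin (A z) | i.1 ∈ K}.Finite := by
  have h1 : {i : Σ z : ℂ, Fin (A z) | i.1 ∈ K} ⊆
      ⋃ z ∈ K ∩ Function.support A, Set.range (Sigma.mk z) := by
    rintro ⟨z, k⟩ hz
    have : A z ≠ 0 := fun h => by have := k.2; omega
    simp only [Set.mem_iUnion]
    exact ⟨z, ⟨hz, this⟩, k, rfl⟩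
  exact (Set.Finite.biUnion (hA K hK) fun z _ => Set.finite_range _).subset h1

theorem countable_index {A : ℂ → ℕ} (hA : LocFiniteSet (Function.support A)) :
    Countable (Σ z : ℂ, Fin (A z)) := by
  rw [← Set.countable_univ_iff]
  have : (Set.univ : Set (Σ z : ℂ, Fin (A z))) ⊆
      ⋃ n : ℕ, {i | i.1 ∈ Metric.closedBall (0 : ℂ) n} := by
    intro i _
    obtain ⟨n, hn⟩ := exists_nat_ge ‖i.1‖
    exact Set.mem_iUnion.2 ⟨n, by simpa using hn⟩
  exact (Set.countable_iUnion fun n =>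
    (finite_index_of_isCompact hA (isCompact_closedBall _ _)).countable).mono this

theorem integral_countingMeasure {A : ℂ → ℕ} (hA : LocFiniteSet (Function.support A))
    {F : ℂ → ℂ} (hF : Summable fun i : Σ z : ℂ, Fin (A z) => ‖F i.1‖) :
    ∫ z, F z ∂(countingMeasure A) = ∑' i : Σ z : ℂ, Fin (A z), F i.1 := by
  have := countable_index hA
  rw [countingMeasure_eq_sum_dirac, integral_sum_measure]
  · simp only [integral_dirac]
  · refine ⟨aestronglyMeasurable_sum_measure_iff.2 fun i => aestronglyMeasurable_dirac, ?_⟩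
    rw [HasFiniteIntegral, lintegral_sum_measure]
    simp only [lintegral_dirac]
    refine lt_of_le_of_lt (le_of_eq (tsum_congr fun i => ?_)) hF.tsum_ofReal_lt_top
    rw [ofReal_norm]

theorem AlmostPeriodicFun.bounded_real {g : ℂ → ℂ} (hg : AlmostPeriodicFun g) :
    ∃ C : ℝ, ∀ t : ℝ, ‖g t‖ ≤ C := by
  obtain ⟨L, hL⟩ := hg.relDense (-1) 1 1 (by norm_num) one_pos
  have hc : ContinuousOn (fun t : ℝ => g t) (Set.Icc 0 L) :=
    (hg.continuous.comp Complex.continuous_ofReal).continuousOn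
  obtain ⟨C, hC⟩ := isCompact_Icc.exists_bound_of_continuousOn hc
  refine ⟨C + 1, fun t => ?_⟩
  -- This almost period moves `t` into `(0, L)`, where `g` is bounded by compactness.
  obtain ⟨τ, hτ, hτ'⟩ := hL (-t)
  have h1 := hτ t (by simp) (by simp)
  have h2 := hC (t + τ) ⟨by linarith [hτ'.1], by linarith [hτ'.2]⟩
  push_cast at h2
  calc ‖g t‖ = ‖g (t + τ) - (g (t + τ) - g t)‖ := by rw [sub_sub_cancel]
    _ ≤ ‖g (t + τ)‖ + ‖g (t + τ) - g t‖ := norm_sub_le _ _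
    _ ≤ C + 1 := add_le_add h2 h1.le

/-- A nonnegative bump equal to `1` on the disc of radius `R` has a convolution with `μ_A` that
dominates the number of points in the disc about `t`; almost periodicity bounds this convolution on
the real axis. -/
theorem exists_card_le_of_almostPeriodic {A : ℂ → ℕ} (hA : LocFiniteSet (Function.support A))
    (hap : AlmostPeriodicMeasure (countingMeasure A)) {R : ℝ} (hR : 0 < R) :
    ∃ C : ℝ, ∀ t : ℝ, ∀ s : Finset (Σ z : ℂ, Fin (A z)),
      (∀ i ∈ s, ‖(t : ℂ) - i.1‖ ≤ R) → (s.card : ℝ) ≤ C := by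
  let φ : ContDiffBump (0 : ℂ) := ⟨R, R + 1, hR, by linarith⟩
  have hφc : Continuous fun z : ℂ => ((φ z : ℝ) : ℂ) :=
    Complex.continuous_ofReal.comp φ.continuous
  have hφs : HasCompactSupport fun z : ℂ => ((φ z : ℝ) : ℂ) :=
    φ.hasCompactSupport.comp_left (g := ((↑) : ℝ → ℂ)) Complex.ofReal_zero
  obtain ⟨C, hC⟩ := (hap _ hφc hφs).bounded_real
  refine ⟨C, fun t s hs => ?_⟩
  have hfin : {i : Σ z : ℂ, Fin (A z) | i.1 ∈ Metric.closedBall (t : ℂ) (R + 1)}.Finite :=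
    finite_index_of_isCompact hA (isCompact_closedBall _ _)
  have hsum : Summable fun i : Σ z : ℂ, Fin (A z) => φ ((t : ℂ) - i.1) := by
    refine summable_of_hasFiniteSupport (hfin.subset fun i hi => ?_)
    by_contra hni
    refine hi (φ.zero_of_le_dist ?_)
    have : ¬ dist i.1 (t : ℂ) ≤ R + 1 := hni
    rw [dist_zero_right, ← dist_eq_norm, dist_comm]
    exact (not_le.1 this).le
  have h1 := hC t
  rw [integral_countingMeasure hA (by
    simpa only [Complex.norm_real, Real.norm_of_nonneg φ.nonneg] using hsum)] at h1
  rw [← Complex.ofReal_tsum, Complex.norm_real, Real.norm_of_nonneg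
    (tsum_nonneg fun i => φ.nonneg)] at h1
  calc (s.card : ℝ) = ∑ i ∈ s, (1 : ℝ) := by simp
    _ ≤ ∑ i ∈ s, φ ((t : ℂ) - i.1) := Finset.sum_le_sum fun i hi => by
        rw [φ.one_of_mem_closedBall]
        simpa using hs i hi
    _ ≤ ∑' i : Σ z : ℂ, Fin (A z), φ ((t : ℂ) - i.1) := hsum.sum_le_tsum _ fun i _ => φ.nonneg
    _ ≤ C := h1

theorem summable_int_inv_sq_add_one : Summable fun n : ℤ => ((n : ℝ) ^ 2 + 1)⁻¹ := by
  have h : Summable fun n : ℤ => 1 / (n : ℝ) ^ 2 := Real.summable_one_div_int_pow.2 one_lt_two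
  refine Summable.of_norm_bounded_eventually h ?_
  filter_upwards [(Set.finite_singleton (0 : ℤ)).compl_mem_cofinite] with n hn
  have hn' : (n : ℝ) ≠ 0 := by exact_mod_cast hn
  have : 0 < (n : ℝ) ^ 2 := by positivity
  rw [Real.norm_of_nonneg (by positivity), one_div]
  gcongr
  linarith

theorem summable_inv_sq_of_almostPeriodic {H : ℝ} {A : ℂ → ℕ} (hA : IsStripMultiset H A)
    (hap : AlmostPeriodicMeasure (countingMeasure A)) :
    Summable fun i : Σ z : ℂ, Fin (A z) => (‖i.1 - (H + 1 : ℝ) * I‖ ^ 2)⁻¹ := by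
  have hAi : ∀ i : Σ z : ℂ, Fin (A z), |i.1.im| ≤ H := fun i =>
    hA.abs_im_le _ fun h => by have := i.2.2; omega
  obtain ⟨C, hC⟩ := exists_card_le_of_almostPeriodic hA.locFinite hap
    (R := |H| + 1) (by positivity)
  refine summable_of_sum_fiber_le (fun i => by positivity) (fun i => ⌊i.1.re⌋)
    ((summable_int_inv_sq_add_one).mul_left (3 * C)) fun k s hs => ?_
  have hk : ∀ i ∈ s, (k : ℝ) ≤ i.1.re ∧ i.1.re < k + 1 := fun i hi => Int.floor_eq_iff.1 (hs i hi)
  have hcard : (s.card : ℝ) ≤ C := by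
    refine hC k s fun i hi => ?_
    obtain ⟨h1, h2⟩ := hk i hi
    refine (Complex.norm_le_abs_re_add_abs_im _).trans ?_
    have h3 : |((k : ℝ) : ℂ).re - i.1.re| ≤ 1 := by
      rw [Complex.ofReal_re, abs_le]; constructor <;> linarith
    have h4 : |((k : ℝ) : ℂ).im - i.1.im| ≤ |H| := by
      rw [Complex.ofReal_im, zero_sub, abs_neg]
      exact (hAi i).trans (le_abs_self H)
    simp only [Complex.sub_re, Complex.sub_im]
    linarith
  have hterm : ∀ i ∈ s, (‖i.1 - (H + 1 : ℝ) * I‖ ^ 2)⁻¹ ≤ 3 * ((k : ℝ) ^ 2 + 1)⁻¹ := by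
    intro i hi
    obtain ⟨h1, h2⟩ := hk i hi
    have h3 := abs_le.1 (hAi i)
    have h4 : ‖i.1 - (H + 1 : ℝ) * I‖ ^ 2 = i.1.re ^ 2 + (i.1.im - (H + 1)) ^ 2 := by
      rw [Complex.sq_norm, Complex.normSq_apply]
      simp
      ring
    have h5 : 1 ≤ (i.1.im - (H + 1)) ^ 2 := by nlinarith
    -- From `|x - k| ≤ 1` one gets `k² ≤ 2x² + 2`, hence `k² + 1 ≤ 3(x² + 1)`.
    rw [h4, show (3 : ℝ) * ((k : ℝ) ^ 2 + 1)⁻¹ = (((k : ℝ) ^ 2 + 1) / 3)⁻¹ by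
      rw [inv_div]; rfl]
    apply inv_anti₀ (by positivity)
    nlinarith [sq_nonneg (i.1.re + 1), sq_nonneg (i.1.re - 1), sq_nonneg (i.1.re)]
  calc ∑ i ∈ s, (‖i.1 - (H + 1 : ℝ) * I‖ ^ 2)⁻¹
      ≤ ∑ i ∈ s, 3 * ((k : ℝ) ^ 2 + 1)⁻¹ := Finset.sum_le_sum hterm
    _ = s.card * (3 * ((k : ℝ) ^ 2 + 1)⁻¹) := by rw [Finset.sum_const, nsmul_eq_mul]
    _ ≤ C * (3 * ((k : ℝ) ^ 2 + 1)⁻¹) := by gcongr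
    _ = 3 * C * ((k : ℝ) ^ 2 + 1)⁻¹ := by ring

/-! ### The canonical product of genus one and its logarithmic derivative. -/

/-- The Weierstrass elementary factor of genus one. -/
def elementaryFactor (u : ℂ) : ℂ := (1 - u) * cexp u

theorem norm_elementaryFactor_sub_one_le {u : ℂ} (hu : ‖u‖ ≤ 1) :
    ‖elementaryFactor u - 1‖ ≤ 3 * ‖u‖ ^ 2 := by
  have h := Complex.norm_exp_sub_one_sub_id_le hu
  have h1 : elementaryFactor u - 1 = -u ^ 2 + (1 - u) * (cexp u - 1 - u) := by
    rw [elementaryFactor]; ring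
  have h2 : ‖1 - u‖ ≤ 2 := (norm_sub_le _ _).trans (by rw [norm_one]; linarith)
  rw [h1]
  calc _ ≤ ‖-u ^ 2‖ + ‖(1 - u) * (cexp u - 1 - u)‖ := norm_add_le _ _
    _ ≤ ‖u‖ ^ 2 + 2 * ‖u‖ ^ 2 := by
        rw [norm_neg, norm_pow, norm_mul]
        gcongr
    _ = _ := by ring

theorem norm_elementaryFactor_le (u : ℂ) : ‖elementaryFactor u‖ ≤ Real.exp (3 * ‖u‖ ^ 2) := by
  rcases le_total ‖u‖ 1 with hu | hu
  · calc ‖elementaryFactor u‖ = ‖(elementaryFactor u - 1) + 1‖ := by rw [sub_add_cancel]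
      _ ≤ ‖elementaryFactor u - 1‖ + ‖(1 : ℂ)‖ := norm_add_le _ _
      _ ≤ 3 * ‖u‖ ^ 2 + 1 := by
          rw [norm_one]; gcongr; exact norm_elementaryFactor_sub_one_le hu
      _ ≤ _ := Real.add_one_le_exp _
  · rw [elementaryFactor, norm_mul]
    have h1 : ‖1 - u‖ ≤ ‖u‖ + 1 := (norm_sub_le _ _).trans (by rw [norm_one]; linarith)
    calc ‖1 - u‖ * ‖cexp u‖ ≤ Real.exp ‖u‖ * Real.exp ‖u‖ := by
          gcongr
          · exact h1.trans (Real.add_one_le_exp _)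
          · rw [Complex.norm_exp]
            exact Real.exp_le_exp.2 (Complex.re_le_norm u)
      _ = Real.exp (‖u‖ + ‖u‖) := (Real.exp_add _ _).symm
      _ ≤ _ := Real.exp_le_exp.2 (by nlinarith)

/-- The canonical product of genus one with zeros `a i`, normalised to be `1` at `p`. -/
def canonicalProduct {ι : Type*} (a : ι → ℂ) (p z : ℂ) : ℂ :=
  ∏' i, elementaryFactor ((z - p) / (a i - p))

section CanonicalProduct

variable {ι : Type*} {a : ι → ℂ} {p : ℂ}

theorem eventually_norm_elementaryFactor_sub_one_le
    (hs : Summable fun i => (‖a i - p‖ ^ 2)⁻¹) (hp : ∀ i, a i ≠ p) (R : ℝ) :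
    ∀ᶠ i in cofinite, ∀ z ∈ Metric.ball p R,
      ‖elementaryFactor ((z - p) / (a i - p)) - 1‖ ≤ 3 * R ^ 2 * (‖a i - p‖ ^ 2)⁻¹ := by
  have h := (hs.mul_left (R ^ 2)).tendsto_cofinite_zero.eventually_le_const one_pos
  filter_upwards [h] with i hi z hz
  rw [Metric.mem_ball, dist_eq_norm] at hz
  have hpos : 0 < ‖a i - p‖ := norm_pos_iff.2 (sub_ne_zero.2 (hp i))
  have hR : 0 ≤ R := (norm_nonneg _).trans hz.le
  have h1 : ‖(z - p) / (a i - p)‖ ^ 2 ≤ R ^ 2 * (‖a i - p‖ ^ 2)⁻¹ := by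
    rw [norm_div, div_pow, div_eq_mul_inv]
    gcongr
  refine (norm_elementaryFactor_sub_one_le ?_).trans ?_
  · have := h1.trans hi
    rwa [sq_le_one_iff₀ (norm_nonneg _)] at this
  · rw [mul_assoc]
    gcongr

theorem differentiable_elementaryFactor : Differentiable ℂ elementaryFactor := by
  unfold elementaryFactor; fun_prop

theorem differentiable_elementaryFactor_comp (p c : ℂ) :
    Differentiable ℂ fun z => elementaryFactor ((z - p) / c) :=
  differentiable_elementaryFactor.comp (by fun_prop)

theorem multipliableLocallyUniformlyOn_elementaryFactor
    (hs : Summable fun i => (‖a i - p‖ ^ 2)⁻¹) (hp : ∀ i, a i ≠ p) (R : ℝ) :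
    MultipliableLocallyUniformlyOn (fun i z => elementaryFactor ((z - p) / (a i - p)))
      (Metric.ball p R) := by
  have := Summable.multipliableLocallyUniformlyOn_one_add
    (f := fun i z => elementaryFactor ((z - p) / (a i - p)) - 1) (K := Metric.ball p R)
    Metric.isOpen_ball (hs.mul_left (3 * R ^ 2))
    (eventually_norm_elementaryFactor_sub_one_le hs hp R)
    (fun i => ((differentiable_elementaryFactor_comp p (a i - p)).continuous.sub
      continuous_const).continuousOn)
  simpa only [add_sub_cancel] using this

theorem mem_ball_norm_sub_add_one (z p : ℂ) : z ∈ Metric.ball p (‖z - p‖ + 1) := by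
  rw [Metric.mem_ball, dist_eq_norm]; linarith

theorem multipliable_elementaryFactor
    (hs : Summable fun i => (‖a i - p‖ ^ 2)⁻¹) (hp : ∀ i, a i ≠ p) (z : ℂ) :
    Multipliable fun i => elementaryFactor ((z - p) / (a i - p)) :=
  (multipliableLocallyUniformlyOn_elementaryFactor hs hp _).multipliable
    (mem_ball_norm_sub_add_one z p)

theorem differentiable_canonicalProduct
    (hs : Summable fun i => (‖a i - p‖ ^ 2)⁻¹) (hp : ∀ i, a i ≠ p) :
    Differentiable ℂ (canonicalProduct a p) := by
  intro z
  have h := (multipliableLocallyUniformlyOn_elementaryFactor hs hp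
    (‖z - p‖ + 1)).hasProdLocallyUniformlyOn
  rw [hasProdLocallyUniformlyOn_iff_tendstoLocallyUniformlyOn] at h
  have hd := h.differentiableOn (Eventually.of_forall fun s =>
    (Differentiable.fun_finsetProd fun i _ =>
      differentiable_elementaryFactor_comp p (a i - p)).differentiableOn) Metric.isOpen_ball
  exact hd.differentiableAt (Metric.isOpen_ball.mem_nhds (mem_ball_norm_sub_add_one z p))

/-- Growth of order at most two: this is the a priori bound that later allows Phragmén–Lindelöf in a
strip. -/
theorem norm_canonicalProduct_le
    (hs : Summable fun i => (‖a i - p‖ ^ 2)⁻¹) (hp : ∀ i, a i ≠ p) (z : ℂ) :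
    ‖canonicalProduct a p z‖ ≤ Real.exp (3 * ‖z - p‖ ^ 2 * ∑' i, (‖a i - p‖ ^ 2)⁻¹) := by
  have h := (multipliable_elementaryFactor hs hp z).hasProd.norm
  refine le_of_tendsto h (Eventually.of_forall fun s => ?_)
  calc ∏ i ∈ s, ‖elementaryFactor ((z - p) / (a i - p))‖
      ≤ ∏ i ∈ s, Real.exp (3 * ‖z - p‖ ^ 2 * (‖a i - p‖ ^ 2)⁻¹) := by
        refine Finset.prod_le_prod (fun i _ => norm_nonneg _) fun i _ => ?_
        refine (norm_elementaryFactor_le _).trans_eq ?_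
        rw [norm_div, div_pow, div_eq_mul_inv, mul_assoc]
    _ = Real.exp (∑ i ∈ s, 3 * ‖z - p‖ ^ 2 * (‖a i - p‖ ^ 2)⁻¹) := (Real.exp_sum _ _).symm
    _ ≤ _ := by
        rw [← Finset.mul_sum]
        refine Real.exp_le_exp.2 (mul_le_mul_of_nonneg_left ?_ (by positivity))
        exact hs.sum_le_tsum _ fun i _ => by positivity

theorem elementaryFactor_eq {c z : ℂ} (hc : c ≠ p) :
    elementaryFactor ((z - p) / (c - p)) =
      (z - c) * (-(c - p)⁻¹ * cexp ((z - p) / (c - p))) := by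
  have : c - p ≠ 0 := sub_ne_zero.2 hc
  rw [elementaryFactor]
  field_simp
  ring

theorem canonicalProduct_ne_zero
    (hs : Summable fun i => (‖a i - p‖ ^ 2)⁻¹) (hp : ∀ i, a i ≠ p) {z : ℂ}
    (hz : ∀ i, a i ≠ z) : canonicalProduct a p z ≠ 0 := by
  have h := tprod_one_add_ne_zero_of_summable
    (f := fun i => elementaryFactor ((z - p) / (a i - p)) - 1) (fun i => ?_) ?_
  · simp only [add_sub_cancel] at h
    exact h
  · rw [add_sub_cancel, elementaryFactor_eq (hp i)]
    have : a i - p ≠ 0 := sub_ne_zero.2 (hp i)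
    exact mul_ne_zero (sub_ne_zero.2 (hz i).symm)
      (mul_ne_zero (neg_ne_zero.2 (inv_ne_zero this)) (Complex.exp_ne_zero _))
  · refine Summable.of_norm_bounded_eventually (hs.mul_left (3 * (‖z - p‖ + 1) ^ 2)) ?_
    filter_upwards [eventually_norm_elementaryFactor_sub_one_le hs hp (‖z - p‖ + 1)] with i hi
    rw [norm_norm]
    exact hi z (mem_ball_norm_sub_add_one z p)

/-- The finitely many factors indexed by `s` contribute `(z - w) ^ s.card` times a zero-free
function; the product over the remaining indices does not vanish at `w`. -/
theorem analyticOrderAt_canonicalProduct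
    (hs : Summable fun i => (‖a i - p‖ ^ 2)⁻¹) (hp : ∀ i, a i ≠ p) {w : ℂ} {s : Finset ι}
    (hw : ∀ i, i ∈ s ↔ a i = w) :
    analyticOrderAt (canonicalProduct a p) w = s.card := by
  have hs' : Summable fun i : {i // i ∉ s} => (‖a i - p‖ ^ 2)⁻¹ := hs.subtype _
  have hp' : ∀ i : {i // i ∉ s}, a i ≠ p := fun i => hp i
  have hd : Differentiable ℂ fun z => (∏ i ∈ s, (-(a i - p)⁻¹ * cexp ((z - p) / (a i - p)))) *
      canonicalProduct (fun i : {i // i ∉ s} => a i) p z :=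
    (Differentiable.fun_finsetProd fun i _ => by fun_prop).mul
      (differentiable_canonicalProduct hs' hp')
  refine ((differentiable_canonicalProduct hs hp).analyticAt w).analyticOrderAt_eq_natCast.2
    ⟨_, hd.analyticAt w, mul_ne_zero (Finset.prod_ne_zero_iff.2 fun i _ => ?_)
      (canonicalProduct_ne_zero hs' hp' fun i hi => i.2 ((hw i).2 hi)),
      Eventually.of_forall fun z => ?_⟩
  · exact mul_ne_zero (neg_ne_zero.2 (inv_ne_zero (sub_ne_zero.2 (hp i)))) (Complex.exp_ne_zero _)
  · have h1 : canonicalProduct a p z = (∏ i ∈ s, elementaryFactor ((z - p) / (a i - p))) *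
        canonicalProduct (fun i : {i // i ∉ s} => a i) p z :=
      (HasProd.mul_compl (s := (s : Set ι))
        (f := fun i => elementaryFactor ((z - p) / (a i - p))) (s.hasProd _)
        (multipliable_elementaryFactor hs' hp' z).hasProd).tprod_eq
    have h2 : ∏ i ∈ s, elementaryFactor ((z - p) / (a i - p)) =
        (z - w) ^ s.card * ∏ i ∈ s, (-(a i - p)⁻¹ * cexp ((z - p) / (a i - p))) := by
      rw [← Finset.prod_const, ← Finset.prod_mul_distrib]
      refine Finset.prod_congr rfl fun i hi => ?_
      rw [elementaryFactor_eq (hp i), (hw i).1 hi]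
    rw [h1, h2, smul_eq_mul, mul_assoc]

theorem logDeriv_elementaryFactor {c z : ℂ} (hc : c ≠ p) (hz : c ≠ z) :
    logDeriv (fun z => elementaryFactor ((z - p) / (c - p))) z = (z - c)⁻¹ + (c - p)⁻¹ := by
  have h1 : c - p ≠ 0 := sub_ne_zero.2 hc
  have h2 : z - c ≠ 0 := sub_ne_zero.2 hz.symm
  have hd : HasDerivAt (fun z => elementaryFactor ((z - p) / (c - p)))
      ((-(1 / (c - p))) * cexp ((z - p) / (c - p)) +
        (1 - (z - p) / (c - p)) * (cexp ((z - p) / (c - p)) * (1 / (c - p)))) z := by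
    have h : HasDerivAt (fun z : ℂ => (z - p) / (c - p)) (1 / (c - p)) z :=
      ((hasDerivAt_id z).sub_const p).div_const _
    exact (h.const_sub 1).mul h.cexp
  rw [logDeriv_apply, hd.deriv, elementaryFactor_eq hc]
  have := Complex.exp_ne_zero ((z - p) / (c - p))
  field_simp
  ring

/-- Distances to `z` and to `p` are comparable once `c` stays at distance `r` from `z`; all
convergence questions thereby reduce to the single series `∑ ‖a i - p‖⁻²`. -/
theorem inv_norm_sub_le {c z : ℂ} {r M : ℝ} (hr : 0 < r) (hc : c ≠ p) (hrz : r ≤ ‖z - c‖)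
    (hM : ‖z - p‖ ≤ M) : ‖z - c‖⁻¹ ≤ (1 + M / r) * ‖c - p‖⁻¹ := by
  have hpos : 0 < ‖c - p‖ := norm_pos_iff.2 (sub_ne_zero.2 hc)
  have hpos' : 0 < ‖z - c‖ := hr.trans_le hrz
  have hM0 : 0 ≤ M := (norm_nonneg _).trans hM
  have h : ‖c - p‖ ≤ ‖z - c‖ * (1 + M / r) := by
    calc ‖c - p‖ = ‖(z - p) - (z - c)‖ := by congr 1; ring
      _ ≤ ‖z - p‖ + ‖z - c‖ := norm_sub_le _ _
      _ ≤ M / r * r + ‖z - c‖ := by rw [div_mul_cancel₀ _ hr.ne']; gcongr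
      _ ≤ M / r * ‖z - c‖ + ‖z - c‖ := by gcongr
      _ = _ := by ring
  rw [inv_eq_one_div, ← div_eq_mul_inv, div_le_div_iff₀ hpos' hpos, one_mul, mul_comm]
  exact h

theorem norm_logDeriv_elementaryFactor_le {c z : ℂ} {r M : ℝ} (hr : 0 < r) (hc : c ≠ p)
    (hrz : r ≤ ‖z - c‖) (hM : ‖z - p‖ ≤ M) :
    ‖(z - c)⁻¹ + (c - p)⁻¹‖ ≤ M * (1 + M / r) * (‖c - p‖ ^ 2)⁻¹ := by
  have h1 : c - p ≠ 0 := sub_ne_zero.2 hc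
  have h2 : z - c ≠ 0 := norm_pos_iff.1 (hr.trans_le hrz)
  have h3 : (z - c)⁻¹ + (c - p)⁻¹ = (z - p) * (z - c)⁻¹ * (c - p)⁻¹ := by
    field_simp
    ring
  have hM0 : 0 ≤ M := (norm_nonneg _).trans hM
  rw [h3, norm_mul, norm_mul, norm_inv, norm_inv]
  calc ‖z - p‖ * ‖z - c‖⁻¹ * ‖c - p‖⁻¹
      ≤ M * ((1 + M / r) * ‖c - p‖⁻¹) * ‖c - p‖⁻¹ := by
        gcongr
        exact inv_norm_sub_le hr hc hrz hM
    _ = _ := by rw [sq, mul_inv]; ring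

theorem summable_logDeriv_elementaryFactor
    (hs : Summable fun i => (‖a i - p‖ ^ 2)⁻¹) (hp : ∀ i, a i ≠ p) {z : ℂ} {r : ℝ} (hr : 0 < r)
    (hz : ∀ i, r ≤ ‖z - a i‖) : Summable fun i => (z - a i)⁻¹ + (a i - p)⁻¹ :=
  Summable.of_norm_bounded (hs.mul_left _) fun i =>
    norm_logDeriv_elementaryFactor_le hr (hp i) (hz i) le_rfl

theorem logDeriv_canonicalProduct
    (hs : Summable fun i => (‖a i - p‖ ^ 2)⁻¹) (hp : ∀ i, a i ≠ p) {z : ℂ} {r : ℝ} (hr : 0 < r)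
    (hz : ∀ i, r ≤ ‖z - a i‖) :
    logDeriv (canonicalProduct a p) z = ∑' i, ((z - a i)⁻¹ + (a i - p)⁻¹) := by
  have hz' : ∀ i, a i ≠ z := fun i h => by
    have := hz i
    rw [h, sub_self, norm_zero] at this
    exact hr.not_ge this
  have hl : ∀ i, logDeriv (fun z => elementaryFactor ((z - p) / (a i - p))) z =
      (z - a i)⁻¹ + (a i - p)⁻¹ := fun i => logDeriv_elementaryFactor (hp i) (hz' i)
  have h := logDeriv_tprod_eq_tsum (s := Metric.ball p (‖z - p‖ + 1)) Metric.isOpen_ball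
    (mem_ball_norm_sub_add_one z p)
    (f := fun i z => elementaryFactor ((z - p) / (a i - p))) (fun i => ?_)
    (fun i => (differentiable_elementaryFactor_comp _ _).differentiableOn) ?_
    (multipliableLocallyUniformlyOn_elementaryFactor hs hp _)
    (canonicalProduct_ne_zero hs hp hz')
  · simp only [hl] at h
    exact h
  · rw [elementaryFactor_eq (hp i)]
    exact mul_ne_zero (sub_ne_zero.2 (hz' i).symm)
      (mul_ne_zero (neg_ne_zero.2 (inv_ne_zero (sub_ne_zero.2 (hp i)))) (Complex.exp_ne_zero _))
  · simp only [hl]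
    exact summable_logDeriv_elementaryFactor hs hp hr hz

theorem hasDerivAt_logDeriv_canonicalProduct
    (hs : Summable fun i => (‖a i - p‖ ^ 2)⁻¹) (hp : ∀ i, a i ≠ p) {z : ℂ} {r : ℝ} (hr : 0 < r)
    (hz : ∀ i, r ≤ ‖z - a i‖) :
    HasDerivAt (logDeriv (canonicalProduct a p)) (-∑' i, ((z - a i) ^ 2)⁻¹) z := by
  -- On the half-radius disc every zero is still at distance `r / 2`, so the series converges
  -- uniformly and can be differentiated termwise.
  set U := Metric.ball z (r / 2) with hU
  have hUr : ∀ w ∈ U, ∀ i, r / 2 ≤ ‖w - a i‖ := by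
    intro w hw i
    rw [hU, Metric.mem_ball, dist_eq_norm, norm_sub_rev] at hw
    have h1 : ‖z - a i‖ ≤ ‖z - w‖ + ‖w - a i‖ := by
      refine le_trans (le_of_eq ?_) (norm_add_le _ _)
      congr 1; ring
    linarith [hz i]
  have hUM : ∀ w ∈ U, ‖w - p‖ ≤ r / 2 + ‖z - p‖ := by
    intro w hw
    rw [hU, Metric.mem_ball, dist_eq_norm] at hw
    have h1 : ‖w - p‖ ≤ ‖w - z‖ + ‖z - p‖ := by
      refine le_trans (le_of_eq ?_) (norm_add_le _ _)
      congr 1; ring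
    linarith
  have hr2 : 0 < r / 2 := half_pos hr
  have hzU : z ∈ U := Metric.mem_ball_self hr2
  have hne : ∀ w ∈ U, ∀ i, w - a i ≠ 0 := fun w hw i =>
    norm_pos_iff.1 (hr2.trans_le (hUr w hw i))
  have hdi : ∀ i, ∀ w ∈ U, HasDerivAt (fun w => (w - a i)⁻¹ + (a i - p)⁻¹)
      (-((w - a i) ^ 2)⁻¹) w := by
    intro i w hw
    have := (((hasDerivAt_id w).sub_const (a i)).inv (hne w hw i)).add_const ((a i - p)⁻¹)
    refine this.congr_deriv ?_
    simp [neg_div]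
  have hdiff : ∀ i, DifferentiableOn ℂ (fun w => (w - a i)⁻¹ + (a i - p)⁻¹) U :=
    fun i w hw => (hdi i w hw).differentiableAt.differentiableWithinAt
  have hb : ∀ i, ∀ w ∈ U, ‖(w - a i)⁻¹ + (a i - p)⁻¹‖ ≤
      (r / 2 + ‖z - p‖) * (1 + (r / 2 + ‖z - p‖) / (r / 2)) * (‖a i - p‖ ^ 2)⁻¹ :=
    fun i w hw => norm_logDeriv_elementaryFactor_le hr2 (hp i) (hUr w hw i) (hUM w hw)
  have hu := hs.mul_left ((r / 2 + ‖z - p‖) * (1 + (r / 2 + ‖z - p‖) / (r / 2)))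
  have hd := Complex.differentiableOn_tsum_of_summable_norm hu hdiff Metric.isOpen_ball hb
  have hsum := Complex.hasSum_deriv_of_summable_norm hu hdiff Metric.isOpen_ball hb hzU
  have h1 := (hd.differentiableAt (Metric.isOpen_ball.mem_nhds hzU)).hasDerivAt
  rw [← hsum.tsum_eq] at h1
  simp only [fun i => (hdi i z hzU).deriv, tsum_neg] at h1
  refine h1.congr_of_eventuallyEq ?_
  filter_upwards [Metric.isOpen_ball.mem_nhds hzU] with w hw
  exact logDeriv_canonicalProduct hs hp hr2 (hUr w hw)

end CanonicalProduct

/-! ### Smooth truncations of `max t 0` and their Laplace transforms. -/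

/-- A smooth approximation of the identity on `(0, ∞)` vanishing on the negative half-line. -/
def smoothRamp (t : ℝ) : ℝ := t * Real.smoothTransition t

/-- A smooth cutoff, equal to `1` on `(-∞, 1]` and to `0` on `[2, ∞)`. -/
def smoothCutoff (t : ℝ) : ℝ := Real.smoothTransition (2 - t)

/-- Compactly supported smooth functions tending to `t ↦ max t 0` as `N → ∞`. -/
def truncatedRamp (N t : ℝ) : ℝ := N⁻¹ * smoothRamp (N * t) * smoothCutoff (t / N)

theorem contDiff_smoothTransition : ContDiff ℝ ∞ Real.smoothTransition :=
  Real.smoothTransition.contDiff (n := ⊤)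

theorem contDiff_smoothRamp : ContDiff ℝ ∞ smoothRamp :=
  contDiff_id.mul contDiff_smoothTransition

theorem contDiff_smoothCutoff : ContDiff ℝ ∞ smoothCutoff :=
  contDiff_smoothTransition.comp (contDiff_const.sub contDiff_id)

theorem contDiff_truncatedRamp (N : ℝ) : ContDiff ℝ ∞ (truncatedRamp N) :=
  (contDiff_const.mul (contDiff_smoothRamp.comp (contDiff_const.mul contDiff_id))).mul
    (contDiff_smoothCutoff.comp (contDiff_id.div_const N))

theorem abs_smoothRamp_le (t : ℝ) : |smoothRamp t| ≤ |t| := by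
  rw [smoothRamp, abs_mul, abs_of_nonneg (Real.smoothTransition.nonneg t)]
  exact mul_le_of_le_one_right (abs_nonneg _) (Real.smoothTransition.le_one t)

theorem smoothCutoff_nonneg (t : ℝ) : 0 ≤ smoothCutoff t := Real.smoothTransition.nonneg _

theorem smoothCutoff_le_one (t : ℝ) : smoothCutoff t ≤ 1 := Real.smoothTransition.le_one _

theorem truncatedRamp_eq {N : ℝ} (hN : 0 < N) (t : ℝ) :
    truncatedRamp N t = t * Real.smoothTransition (N * t) * smoothCutoff (t / N) := by
  rw [truncatedRamp, smoothRamp]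
  field_simp

theorem truncatedRamp_of_nonpos {N t : ℝ} (hN : 0 < N) (ht : t ≤ 0) : truncatedRamp N t = 0 := by
  rw [truncatedRamp_eq hN, Real.smoothTransition.zero_of_nonpos
    (mul_nonpos_of_nonneg_of_nonpos hN.le ht)]
  simp

theorem abs_truncatedRamp_le {N : ℝ} (hN : 0 < N) (t : ℝ) : |truncatedRamp N t| ≤ max t 0 := by
  rcases le_total t 0 with ht | ht
  · rw [truncatedRamp_of_nonpos hN ht, abs_zero]; exact le_max_right _ _
  · rw [truncatedRamp_eq hN, max_eq_left ht, mul_assoc, abs_mul, abs_of_nonneg ht, abs_mul,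
      abs_of_nonneg (Real.smoothTransition.nonneg _), abs_of_nonneg (smoothCutoff_nonneg _)]
    exact mul_le_of_le_one_right ht (mul_le_one₀ (Real.smoothTransition.le_one _)
      (smoothCutoff_nonneg _) (smoothCutoff_le_one _))

theorem tendsto_truncatedRamp (t : ℝ) :
    Tendsto (fun n : ℕ => truncatedRamp (n + 1) t) atTop (nhds (max t 0)) := by
  rcases le_or_gt t 0 with ht | ht
  · rw [max_eq_right ht]
    refine tendsto_const_nhds.congr fun n => ?_
    rw [truncatedRamp_of_nonpos (by positivity) ht]
  · rw [max_eq_left ht.le]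
    refine tendsto_const_nhds.congr' ?_
    obtain ⟨m, hm⟩ := exists_nat_ge (max t (1 / t))
    filter_upwards [eventually_ge_atTop m] with n hn
    have hn' : (m : ℝ) ≤ n := by exact_mod_cast hn
    have h1 : t ≤ n + 1 := by linarith [le_max_left t (1 / t)]
    have h2 : 1 / t ≤ n + 1 := by linarith [le_max_right t (1 / t)]
    have hpos : (0 : ℝ) < n + 1 := by positivity
    rw [truncatedRamp_eq hpos, smoothCutoff, Real.smoothTransition.one_of_one_le,
      Real.smoothTransition.one_of_one_le]
    · ring
    · have : t / (n + 1) ≤ 1 := (div_le_one hpos).2 h1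
      linarith
    · rwa [div_le_iff₀ ht] at h2

theorem hasCompactSupport_truncatedRamp {N : ℝ} (hN : 0 < N) :
    HasCompactSupport (truncatedRamp N) := by
  refine HasCompactSupport.intro (isCompact_Icc (a := 0) (b := 2 * N)) fun t ht => ?_
  rcases le_total t 0 with h | h
  · exact truncatedRamp_of_nonpos hN h
  · have h2 : 2 * N < t := by
      by_contra hc
      exact ht ⟨h, not_lt.1 hc⟩
    have h3 : 2 ≤ t / N := by rw [le_div_iff₀ hN]; exact h2.le
    rw [truncatedRamp, smoothCutoff, Real.smoothTransition.zero_of_nonpos (by linarith), mul_zero]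

theorem hasCompactSupport_deriv_of_eventuallyEq_const {f : ℝ → ℝ} {R c d : ℝ}
    (h1 : ∀ t < -R, f t = c) (h2 : ∀ t > R, f t = d) : HasCompactSupport (deriv f) := by
  refine HasCompactSupport.intro (isCompact_Icc (a := -R) (b := R)) fun t ht => ?_
  by_cases hl : t < -R
  · have : f =ᶠ[nhds t] fun _ => c := by
      filter_upwards [Iio_mem_nhds hl] with s hs using h1 s hs
    rw [this.deriv_eq, deriv_const]
  · have hr : R < t := by
      by_contra hc
      exact ht ⟨not_lt.1 hl, not_lt.1 hc⟩
    have : f =ᶠ[nhds t] fun _ => d := by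
      filter_upwards [Ioi_mem_nhds hr] with s hs using h2 s hs
    rw [this.deriv_eq, deriv_const]

theorem deriv_smoothRamp (t : ℝ) :
    deriv smoothRamp t = Real.smoothTransition t + t * deriv Real.smoothTransition t := by
  have h := (hasDerivAt_id t).mul
    ((contDiff_smoothTransition.differentiable (by simp)) t).hasDerivAt
  have := h.deriv
  simp only [id, one_mul] at this
  exact this

theorem deriv_smoothTransition_of_lt {t : ℝ} (ht : t < 0) : deriv Real.smoothTransition t = 0 := by
  have : Real.smoothTransition =ᶠ[nhds t] fun _ => 0 := by
    filter_upwards [Iio_mem_nhds ht] with s hs using Real.smoothTransition.zero_of_nonpos hs.le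
  rw [this.deriv_eq, deriv_const]

theorem deriv_smoothTransition_of_gt {t : ℝ} (ht : 1 < t) : deriv Real.smoothTransition t = 0 := by
  have : Real.smoothTransition =ᶠ[nhds t] fun _ => 1 := by
    filter_upwards [Ioi_mem_nhds ht] with s hs using Real.smoothTransition.one_of_one_le hs.le
  rw [this.deriv_eq, deriv_const]

theorem hasCompactSupport_deriv_smoothTransition :
    HasCompactSupport (deriv Real.smoothTransition) :=
  hasCompactSupport_deriv_of_eventuallyEq_const (R := 1) (c := 0) (d := 1)
    (fun _ ht => Real.smoothTransition.zero_of_nonpos (by linarith))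
    (fun _ ht => Real.smoothTransition.one_of_one_le ht.le)

theorem exists_abs_deriv_smoothRamp_le : ∃ C, ∀ t, |deriv smoothRamp t| ≤ C := by
  have hc : Continuous fun t : ℝ => t * deriv Real.smoothTransition t :=
    continuous_id.mul (contDiff_infty_iff_deriv.1 contDiff_smoothTransition).2.continuous
  obtain ⟨C, hC⟩ := hc.bounded_above_of_compact_support
    (hasCompactSupport_deriv_smoothTransition.mul_left)
  refine ⟨1 + C, fun t => ?_⟩
  rw [deriv_smoothRamp]
  refine (abs_add_le _ _).trans (add_le_add ?_ (hC t))
  rw [abs_of_nonneg (Real.smoothTransition.nonneg _)]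
  exact Real.smoothTransition.le_one _

theorem hasCompactSupport_deriv_deriv_smoothRamp :
    HasCompactSupport (deriv (deriv smoothRamp)) := by
  refine hasCompactSupport_deriv_of_eventuallyEq_const (R := 1) (c := 0) (d := 1)
    (fun t ht => ?_) fun t ht => ?_
  · rw [deriv_smoothRamp, deriv_smoothTransition_of_lt (by linarith),
      Real.smoothTransition.zero_of_nonpos (by linarith)]
    ring
  · rw [deriv_smoothRamp, deriv_smoothTransition_of_gt ht,
      Real.smoothTransition.one_of_one_le (le_of_lt ht)]
    ring

theorem hasCompactSupport_deriv_smoothCutoff : HasCompactSupport (deriv smoothCutoff) :=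
  hasCompactSupport_deriv_of_eventuallyEq_const (R := 2) (c := 1) (d := 0)
    (fun _ _ => Real.smoothTransition.one_of_one_le (by linarith))
    (fun _ _ => Real.smoothTransition.zero_of_nonpos (by linarith))

theorem deriv_truncatedRamp {N : ℝ} (hN : N ≠ 0) :
    deriv (truncatedRamp N) = fun t => deriv smoothRamp (N * t) * smoothCutoff (t / N) +
      N⁻¹ * smoothRamp (N * t) * (deriv smoothCutoff (t / N) / N) := by
  ext t
  have h1 : HasDerivAt (fun t => smoothRamp (N * t)) (deriv smoothRamp (N * t) * (N * 1)) t :=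
    ((contDiff_smoothRamp.differentiable (by simp)) (N * t)).hasDerivAt.comp t
      ((hasDerivAt_id t).const_mul N)
  have h2 : HasDerivAt (fun t => smoothCutoff (t / N)) (deriv smoothCutoff (t / N) * (1 / N)) t :=
    HasDerivAt.comp (h₂ := smoothCutoff) t
      ((contDiff_smoothCutoff.differentiable (by simp)) (t / N)).hasDerivAt
      ((hasDerivAt_id t).div_const N)
  have h := ((h1.const_mul N⁻¹).mul h2).deriv
  refine h.trans ?_
  field_simp

theorem deriv_deriv_truncatedRamp {N : ℝ} (hN : N ≠ 0) :
    deriv (deriv (truncatedRamp N)) = fun t =>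
      N * deriv (deriv smoothRamp) (N * t) * smoothCutoff (t / N) +
      2 * deriv smoothRamp (N * t) * (deriv smoothCutoff (t / N) / N) +
      N⁻¹ * smoothRamp (N * t) * (deriv (deriv smoothCutoff) (t / N) / N ^ 2) := by
  rw [deriv_truncatedRamp hN]
  ext t
  have hd : ∀ {f : ℝ → ℝ}, ContDiff ℝ ∞ f → ∀ c x : ℝ,
      HasDerivAt (fun x => f (c * x)) (deriv f (c * x) * (c * 1)) x := fun hf c x =>
    ((hf.differentiable (by simp)) _).hasDerivAt.comp x ((hasDerivAt_id x).const_mul c)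
  have hd' : ∀ {f : ℝ → ℝ}, ContDiff ℝ ∞ f → ∀ c x : ℝ,
      HasDerivAt (fun x => f (x / c)) (deriv f (x / c) * (1 / c)) x := fun hf c x =>
    ((hf.differentiable (by simp)) _).hasDerivAt.comp x ((hasDerivAt_id x).div_const c)
  have h1 := hd contDiff_smoothRamp N t
  have h1' := hd (contDiff_infty_iff_deriv.1 contDiff_smoothRamp).2 N t
  have h2 := hd' contDiff_smoothCutoff N t
  have h2' := hd' (contDiff_infty_iff_deriv.1 contDiff_smoothCutoff).2 N t
  have h := ((h1'.mul h2).add ((h1.const_mul N⁻¹).mul (h2'.div_const N))).deriv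
  refine h.trans ?_
  field_simp
  ring

theorem integrable_deriv_deriv_truncatedRamp {N : ℝ} (hN : 0 < N) :
    Integrable (deriv (deriv (truncatedRamp N))) :=
  (contDiff_infty_iff_deriv.1 (contDiff_infty_iff_deriv.1
    (contDiff_truncatedRamp N)).2).2.continuous.integrable_of_hasCompactSupport
    (hasCompactSupport_truncatedRamp hN).deriv.deriv

/-- Each of the three terms of the second derivative has, after rescaling by `N` or `1/N`, an L¹
bound independent of `N`. Here `|smoothRamp t| ≤ |t|` and the boundedness of its derivative are
used. -/
theorem exists_integral_abs_deriv_deriv_truncatedRamp_le :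
    ∃ C, 0 ≤ C ∧ ∀ N > 0, ∫ t, |deriv (deriv (truncatedRamp N)) t| ≤ C := by
  obtain ⟨C, hC⟩ := exists_abs_deriv_smoothRamp_le
  have hC0 : 0 ≤ C := (abs_nonneg _).trans (hC 0)
  have c1 := (contDiff_infty_iff_deriv.1 (contDiff_infty_iff_deriv.1
    contDiff_smoothRamp).2).2.continuous
  have c2 := (contDiff_infty_iff_deriv.1 contDiff_smoothCutoff).2.continuous
  have c3 := (contDiff_infty_iff_deriv.1 (contDiff_infty_iff_deriv.1
    contDiff_smoothCutoff).2).2.continuous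
  have i1 : Integrable fun t => |deriv (deriv smoothRamp) t| :=
    (c1.integrable_of_hasCompactSupport hasCompactSupport_deriv_deriv_smoothRamp).abs
  have i2 : Integrable fun t => |deriv smoothCutoff t| :=
    (c2.integrable_of_hasCompactSupport hasCompactSupport_deriv_smoothCutoff).abs
  have i3 : Integrable fun t => |t * deriv (deriv smoothCutoff) t| :=
    ((continuous_id.mul c3).integrable_of_hasCompactSupport
      hasCompactSupport_deriv_smoothCutoff.deriv.mul_left).abs
  refine ⟨(∫ t, |deriv (deriv smoothRamp) t|) + 2 * C * (∫ t, |deriv smoothCutoff t|) +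
    ∫ t, |t * deriv (deriv smoothCutoff) t|, ?_, fun N hN => ?_⟩
  · have h0 : ∀ f : ℝ → ℝ, 0 ≤ ∫ t, |f t| := fun f => integral_nonneg fun t => abs_nonneg (f t)
    exact add_nonneg (add_nonneg (h0 _) (mul_nonneg (by positivity) (h0 _))) (h0 _)
  have j1 : Integrable fun t => N * |deriv (deriv smoothRamp) (N * t)| :=
    (i1.comp_mul_left' hN.ne').const_mul N
  have j2 : Integrable fun t => 2 * C * (N⁻¹ * |deriv smoothCutoff (t / N)|) :=
    ((i2.comp_div hN.ne').const_mul _).const_mul _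
  have j3 : Integrable fun t => N⁻¹ * |t / N * deriv (deriv smoothCutoff) (t / N)| :=
    (i3.comp_div hN.ne').const_mul _
  have hle : ∀ t, |deriv (deriv (truncatedRamp N)) t| ≤
      N * |deriv (deriv smoothRamp) (N * t)| + 2 * C * (N⁻¹ * |deriv smoothCutoff (t / N)|) +
      N⁻¹ * |t / N * deriv (deriv smoothCutoff) (t / N)| := by
    intro t
    rw [deriv_deriv_truncatedRamp hN.ne']
    refine (abs_add_le _ _).trans (add_le_add ((abs_add_le _ _).trans (add_le_add ?_ ?_)) ?_)
    · rw [abs_mul, abs_mul, abs_of_pos hN, abs_of_nonneg (smoothCutoff_nonneg _)]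
      exact mul_le_of_le_one_right (by positivity) (smoothCutoff_le_one _)
    · rw [abs_mul, abs_mul, abs_two, abs_div, abs_of_pos hN, div_eq_inv_mul]
      gcongr
      exact hC _
    · rw [abs_mul, abs_mul, abs_div, abs_mul, abs_div, abs_of_pos (inv_pos.2 hN),
        abs_of_pos (pow_pos hN 2), abs_of_pos hN]
      have h1 : |smoothRamp (N * t)| ≤ N * |t| :=
        (abs_smoothRamp_le _).trans (by rw [abs_mul, abs_of_pos hN])
      calc N⁻¹ * |smoothRamp (N * t)| * (|deriv (deriv smoothCutoff) (t / N)| / N ^ 2)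
          ≤ N⁻¹ * (N * |t|) * (|deriv (deriv smoothCutoff) (t / N)| / N ^ 2) := by gcongr
        _ = _ := by field_simp
  calc ∫ t, |deriv (deriv (truncatedRamp N)) t| ≤ ∫ t, (N * |deriv (deriv smoothRamp) (N * t)| +
        2 * C * (N⁻¹ * |deriv smoothCutoff (t / N)|) +
        N⁻¹ * |t / N * deriv (deriv smoothCutoff) (t / N)|) :=
        integral_mono (integrable_deriv_deriv_truncatedRamp hN).abs ((j1.add j2).add j3) hle
    _ = _ := by
      rw [integral_add (by exact j1.add j2) j3, integral_add j1 j2, integral_const_mul, integral_const_mul,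
        integral_const_mul, integral_const_mul,
        Measure.integral_comp_mul_left (fun t => |deriv (deriv smoothRamp) t|),
        Measure.integral_comp_div (fun t => |deriv smoothCutoff t|),
        Measure.integral_comp_div (fun t => |t * deriv (deriv smoothCutoff) t|),
        abs_of_pos hN, abs_of_pos (inv_pos.2 hN)]
      simp only [smul_eq_mul]
      rw [inv_mul_cancel_left₀ hN.ne', inv_mul_cancel_left₀ hN.ne', mul_inv_cancel_left₀ hN.ne']

theorem integral_mul_cexp_eq_of_hasCompactSupport {h : ℝ → ℂ} (hh : ContDiff ℝ ∞ h)
    (hc : HasCompactSupport h) {s : ℂ} (hs : s ≠ 0) :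
    ∫ t, h t * cexp (s * t) = -s⁻¹ * ∫ t, deriv h t * cexp (s * t) := by
  have hE : ∀ x : ℝ, HasDerivAt (fun t : ℝ => s⁻¹ * cexp (s * t)) (cexp (s * x)) x := by
    intro x
    have h1 : HasDerivAt (fun t : ℝ => s * (t : ℂ)) (s * 1) x :=
      (Complex.ofRealCLM.hasDerivAt (x := x)).const_mul s
    refine (h1.cexp.const_mul s⁻¹).congr_deriv ?_
    field_simp
  have hEc : Continuous fun t : ℝ => cexp (s * t) := by fun_prop
  have hdc := (contDiff_infty_iff_deriv.1 hh).2.continuous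
  have := integral_mul_deriv_eq_deriv_mul_of_integrable (u := h) (u' := deriv h)
    (v := fun t : ℝ => s⁻¹ * cexp (s * t)) (v' := fun t : ℝ => cexp (s * t))
    (fun x _ => (hh.differentiable (by simp) x).hasDerivAt) (fun x _ => hE x)
    ((hh.continuous.mul hEc).integrable_of_hasCompactSupport hc.mul_right)
    ((hdc.mul (continuous_const.mul hEc)).integrable_of_hasCompactSupport hc.deriv.mul_right)
    ((hh.continuous.mul (continuous_const.mul hEc)).integrable_of_hasCompactSupport hc.mul_right)
  rw [this, neg_mul, ← integral_const_mul]
  congr 2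
  ext t
  ring

/-- Two integrations by parts give the factor `s⁻²`. The uniformity in `N` provides the summable
majorant needed to pass to the limit in the sum over the points of `A`. -/
theorem exists_norm_integral_truncatedRamp_mul_cexp_le :
    ∃ C, 0 ≤ C ∧ ∀ N > 0, ∀ s : ℂ, s.re < 0 →
      ‖∫ t : ℝ, (truncatedRamp N t : ℂ) * cexp (s * t)‖ ≤ C * (‖s‖ ^ 2)⁻¹ := by
  obtain ⟨C, hC0, hC⟩ := exists_integral_abs_deriv_deriv_truncatedRamp_le
  refine ⟨C, hC0, fun N hN s hs => ?_⟩
  have hs0 : s ≠ 0 := by rintro rfl; simp at hs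
  have hsm : ∀ f : ℝ → ℝ, ContDiff ℝ ∞ f → ContDiff ℝ ∞ fun t => (f t : ℂ) := fun f hf =>
    Complex.ofRealCLM.contDiff.comp hf
  have hder : ∀ f : ℝ → ℝ, ContDiff ℝ ∞ f →
      deriv (fun t => (f t : ℂ)) = fun t => ((deriv f t : ℝ) : ℂ) := fun f hf => by
    ext t
    exact ((hf.differentiable (by simp) t).hasDerivAt.ofReal_comp).deriv
  have hcs : ∀ f : ℝ → ℝ, HasCompactSupport f → HasCompactSupport fun t => (f t : ℂ) :=
    fun f hf => hf.comp_left (g := ((↑) : ℝ → ℂ)) Complex.ofReal_zero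
  have d0 := contDiff_truncatedRamp N
  have d1 := (contDiff_infty_iff_deriv.1 d0).2
  have k0 := hasCompactSupport_truncatedRamp hN
  rw [integral_mul_cexp_eq_of_hasCompactSupport (hsm _ d0) (hcs _ k0) hs0, hder _ d0,
    integral_mul_cexp_eq_of_hasCompactSupport (hsm _ d1) (hcs _ k0.deriv) hs0, hder _ d1,
    ← mul_assoc, norm_mul, norm_mul, norm_neg, norm_inv, mul_comm, ← mul_inv, ← sq]
  gcongr
  refine (norm_integral_le_integral_norm _).trans (le_trans ?_ (hC N hN))
  refine integral_mono_of_nonneg (Eventually.of_forall fun t => norm_nonneg _)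
    (integrable_deriv_deriv_truncatedRamp hN).abs (Eventually.of_forall fun t => ?_)
  simp only [norm_mul, Complex.norm_real, Real.norm_eq_abs]
  -- The exponential is at most `1` only for `t ≥ 0`; on the negative half-line the second
  -- derivative vanishes.
  rcases lt_or_ge t 0 with ht | ht
  · have : truncatedRamp N =ᶠ[nhds t] fun _ => 0 := by
      filter_upwards [Iio_mem_nhds ht] with x hx using truncatedRamp_of_nonpos hN hx.le
    have h2 : deriv (deriv (truncatedRamp N)) t = 0 := by
      rw [this.deriv.deriv_eq]; simp
    rw [h2, abs_zero, zero_mul]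
  · refine mul_le_of_le_one_right (abs_nonneg _) ?_
    rw [Complex.norm_exp, Real.exp_le_one_iff]
    simp only [Complex.mul_re, Complex.ofReal_re, Complex.ofReal_im, mul_zero, sub_zero]
    exact mul_nonpos_of_nonpos_of_nonneg hs.le ht

/-- Half of the exponential decay pays for the linear factor. -/
theorem mul_exp_neg_le {δ t : ℝ} (hδ : 0 < δ) :
    t * Real.exp (-δ * t) ≤ 2 / δ * Real.exp (-(δ / 2) * t) := by
  have h1 : δ / 2 * t ≤ Real.exp (δ / 2 * t) := by
    linarith [Real.add_one_le_exp (δ / 2 * t)]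
  have h2 : Real.exp (-δ * t) = Real.exp (-(δ / 2) * t) * Real.exp (-(δ / 2) * t) := by
    rw [← Real.exp_add]; congr 1; ring
  have h3 : Real.exp (δ / 2 * t) * Real.exp (-(δ / 2) * t) = 1 := by
    rw [← Real.exp_add]; simp
  have h4 := Real.exp_pos (-(δ / 2) * t)
  have h5 : t = 2 / δ * (δ / 2 * t) := by field_simp
  rw [h2]
  calc t * (Real.exp (-(δ / 2) * t) * Real.exp (-(δ / 2) * t))
      = 2 / δ * (δ / 2 * t) * (Real.exp (-(δ / 2) * t) * Real.exp (-(δ / 2) * t)) := by rw [← h5]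
    _ ≤ 2 / δ * Real.exp (δ / 2 * t) * (Real.exp (-(δ / 2) * t) * Real.exp (-(δ / 2) * t)) := by
        gcongr
    _ = 2 / δ * (Real.exp (δ / 2 * t) * Real.exp (-(δ / 2) * t)) * Real.exp (-(δ / 2) * t) := by
        ring
    _ = _ := by rw [h3, mul_one]

theorem max_mul_exp_le_indicator {δ : ℝ} (hδ : 0 < δ) (t : ℝ) :
    max t 0 * Real.exp (-δ * t) ≤
      (Set.Ioi 0).indicator (fun t => 2 / δ * Real.exp (-(δ / 2) * t)) t := by
  rcases le_or_gt t 0 with ht | ht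
  · rw [max_eq_right ht, zero_mul, Set.indicator_of_notMem (by simpa using ht)]
  · rw [max_eq_left ht.le, Set.indicator_of_mem (by simpa using ht)]
    exact mul_exp_neg_le hδ

theorem integrable_indicator_exp {δ : ℝ} (hδ : 0 < δ) :
    Integrable ((Set.Ioi 0).indicator fun t => 2 / δ * Real.exp (-(δ / 2) * t)) :=
  IntegrableOn.integrable_indicator
    ((integrableOn_exp_mul_Ioi (by linarith) 0).const_mul _) measurableSet_Ioi

theorem norm_max_mul_cexp (s : ℂ) (t : ℝ) :
    ‖((max t 0 : ℝ) : ℂ) * cexp (s * t)‖ = max t 0 * Real.exp (-(-s.re) * t) := by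
  rw [norm_mul, Complex.norm_real, Real.norm_of_nonneg (le_max_right _ _), Complex.norm_exp]
  simp

theorem integral_max_mul_cexp {s : ℂ} (hs : s.re < 0) :
    ∫ t : ℝ, ((max t 0 : ℝ) : ℂ) * cexp (s * t) = (s ^ 2)⁻¹ := by
  have hs0 : s ≠ 0 := by rintro rfl; simp at hs
  have hδ : 0 < -s.re := by linarith
  have hint : Integrable fun t : ℝ => ((max t 0 : ℝ) : ℂ) * cexp (s * t) :=
    (integrable_indicator_exp hδ).mono' (by fun_prop) (Eventually.of_forall fun t => by
      rw [norm_max_mul_cexp]; exact max_mul_exp_le_indicator hδ t)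
  have h0 : ∫ t : ℝ, ((max t 0 : ℝ) : ℂ) * cexp (s * t) =
      ∫ t in Set.Ioi (0 : ℝ), ((max t 0 : ℝ) : ℂ) * cexp (s * t) :=
    (setIntegral_eq_integral_of_forall_compl_eq_zero fun t ht => by
      rw [max_eq_right (by simpa using ht)]; simp).symm
  have hd : ∀ t ∈ Set.Ioi (0 : ℝ), HasDerivAt (fun t : ℝ => (t / s - (s ^ 2)⁻¹) * cexp (s * t))
      (((max t 0 : ℝ) : ℂ) * cexp (s * t)) t := by
    intro t ht
    have h1 : HasDerivAt (fun t : ℝ => s * (t : ℂ)) (s * 1) t :=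
      (Complex.ofRealCLM.hasDerivAt (x := t)).const_mul s
    have h2 : HasDerivAt (fun t : ℝ => (t : ℂ) / s - (s ^ 2)⁻¹) (1 / s) t :=
      ((Complex.ofRealCLM.hasDerivAt (x := t)).div_const s).sub_const _
    refine (h2.mul h1.cexp).congr_deriv ?_
    rw [max_eq_left (le_of_lt ht)]
    field_simp
    ring
  have hlim : Tendsto (fun t : ℝ => ((t : ℂ) / s - (s ^ 2)⁻¹) * cexp (s * t)) atTop (nhds 0) := by
    have e1 : Tendsto (fun t : ℝ => Real.exp (-(-s.re / 2) * t)) atTop (nhds 0) :=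
      Real.tendsto_exp_atBot.comp (tendsto_id.const_mul_atTop_of_neg (by linarith))
    have e2 : Tendsto (fun t : ℝ => Real.exp (-(-s.re) * t)) atTop (nhds 0) :=
      Real.tendsto_exp_atBot.comp (tendsto_id.const_mul_atTop_of_neg (by linarith))
    have e3 : Tendsto (fun t : ℝ => ‖s‖⁻¹ * (2 / (-s.re) * Real.exp (-(-s.re / 2) * t)) +
        ‖(s ^ 2)⁻¹‖ * Real.exp (-(-s.re) * t)) atTop (nhds 0) := by
      simpa only [mul_zero, add_zero] using ((e1.const_mul (2 / (-s.re))).const_mul ‖s‖⁻¹).add (e2.const_mul ‖(s ^ 2)⁻¹‖)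
    refine squeeze_zero_norm' ?_ e3
    filter_upwards [eventually_ge_atTop 0] with t ht
    have hn : ‖cexp (s * t)‖ = Real.exp (-(-s.re) * t) := by
      rw [Complex.norm_exp]; simp
    rw [norm_mul, hn]
    calc ‖(t : ℂ) / s - (s ^ 2)⁻¹‖ * Real.exp (-(-s.re) * t)
        ≤ (‖(t : ℂ) / s‖ + ‖(s ^ 2)⁻¹‖) * Real.exp (-(-s.re) * t) := by
          gcongr; exact norm_sub_le _ _
      _ = ‖s‖⁻¹ * (t * Real.exp (-(-s.re) * t)) + ‖(s ^ 2)⁻¹‖ * Real.exp (-(-s.re) * t) := by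
          rw [norm_div, Complex.norm_real, Real.norm_of_nonneg ht]; ring
      _ ≤ _ := by
          exact add_le_add_left (mul_le_mul_of_nonneg_left (mul_exp_neg_le hδ) (by positivity)) _
  rw [h0, integral_Ioi_of_hasDerivAt_of_tendsto (by fun_prop) hd hint.integrableOn hlim]
  simp

theorem tendsto_integral_truncatedRamp_mul_cexp {s : ℂ} (hs : s.re < 0) :
    Tendsto (fun n : ℕ => ∫ t : ℝ, (truncatedRamp (n + 1) t : ℂ) * cexp (s * t)) atTop
      (nhds (s ^ 2)⁻¹) := by
  have hδ : 0 < -s.re := by linarith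
  rw [← integral_max_mul_cexp hs]
  refine tendsto_integral_of_dominated_convergence _ (fun n => ?_) (integrable_indicator_exp hδ)
    (fun n => Eventually.of_forall fun t => ?_) (Eventually.of_forall fun t => ?_)
  · have := (contDiff_truncatedRamp (n + 1)).continuous
    fun_prop
  · refine le_trans ?_ (max_mul_exp_le_indicator hδ t)
    rw [← norm_max_mul_cexp, norm_mul, norm_mul, Complex.norm_real, Complex.norm_real,
      Real.norm_of_nonneg (le_max_right t 0)]
    gcongr
    exact abs_truncatedRamp_le (by positivity) t
  · exact ((Complex.continuous_ofReal.tendsto _).comp (tendsto_truncatedRamp t)).mul_const _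

/-! ### Exponentially weighted summability of the masses `b_γ`. -/

theorem sum_le_tsum_subtype {ι : Type*} {f : ι → ℝ} (hf : ∀ i, 0 ≤ f i) {p : ι → Prop}
    (hs : Summable fun i : {i // p i} => f i) (s : Finset ι) (hsp : ∀ i ∈ s, p i) :
    ∑ i ∈ s, f i ≤ ∑' i : {i // p i}, f i := by
  classical
  rw [← Finset.sum_subtype_of_mem f hsp]
  exact hs.sum_le_tsum _ fun i _ => hf i

/-- The mass of `|γ| < n + 1` is eventually at most `e^{K(n+1)}`; the weight `e^{-(K+1)|γ|}` leaves
a geometric series over the shells `n ≤ |γ| < n + 1`. -/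
theorem exists_summable_norm_mul_exp {b : ℝ → ℂ}
    (hb : ∀ r : ℝ, Summable fun γ : {γ : ℝ // |γ| < r} => ‖b γ‖)
    (hvar : (fun r : ℝ => Real.log (∑' γ : {γ : ℝ // |γ| < r}, ‖b γ‖)) =O[atTop] fun r : ℝ => r) :
    ∃ η > 0, Summable fun γ : ℝ => ‖b γ‖ * Real.exp (-(2 * Real.pi * η * |γ|)) := by
  obtain ⟨K, hK, hKr⟩ := hvar.exists_pos
  obtain ⟨r₀, hr₀⟩ := eventually_atTop.1 hKr.bound
  have hV : ∀ r : ℝ, max r₀ 0 ≤ r → ∑' γ : {γ : ℝ // |γ| < r}, ‖b γ‖ ≤ Real.exp (K * r) := by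
    intro r hr
    have h1 := hr₀ r ((le_max_left _ _).trans hr)
    rw [Real.norm_of_nonneg ((le_max_right _ _).trans hr)] at h1
    have h0 : 0 ≤ ∑' γ : {γ : ℝ // |γ| < r}, ‖b γ‖ := tsum_nonneg fun _ => norm_nonneg _
    -- A vanishing sum is treated apart because `Real.log 0 = 0` is only a default value; the bound
    -- is then trivial.
    rcases h0.eq_or_lt with h | h
    · rw [← h]; positivity
    · exact (Real.log_le_iff_le_exp h).1 ((le_abs_self _).trans h1)
  have hpi := Real.pi_pos
  refine ⟨(K + 1) / (2 * Real.pi), by positivity, ?_⟩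
  have hη : 2 * Real.pi * ((K + 1) / (2 * Real.pi)) = K + 1 := by field_simp
  rw [hη]
  have hu : Summable fun n : ℕ =>
      (∑' γ : {γ : ℝ // |γ| < (n : ℝ) + 1}, ‖b γ‖) * Real.exp (-((K + 1) * n)) := by
    refine Summable.of_norm_bounded_eventually_nat
      (Real.summable_exp_neg_nat.mul_left (Real.exp K)) ?_
    obtain ⟨m, hm⟩ := exists_nat_ge (max r₀ 0)
    filter_upwards [eventually_ge_atTop m] with n hn
    have hn' : (m : ℝ) ≤ n := by exact_mod_cast hn
    rw [norm_mul, Real.norm_of_nonneg (tsum_nonneg fun _ => norm_nonneg _),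
      Real.norm_of_nonneg (Real.exp_pos _).le]
    calc _ ≤ Real.exp (K * (n + 1)) * Real.exp (-((K + 1) * n)) := by
          gcongr; exact hV _ (by linarith)
      _ = _ := by rw [← Real.exp_add, ← Real.exp_add]; congr 1; ring
  refine summable_of_sum_fiber_le (fun γ => by positivity) (fun γ => ⌊|γ|⌋₊) hu fun n s hs => ?_
  have hn : ∀ γ ∈ s, (n : ℝ) ≤ |γ| ∧ |γ| < n + 1 := fun γ hγ =>
    (Nat.floor_eq_iff (abs_nonneg γ)).1 (hs γ hγ)
  calc ∑ γ ∈ s, ‖b γ‖ * Real.exp (-((K + 1) * |γ|))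
      ≤ ∑ γ ∈ s, ‖b γ‖ * Real.exp (-((K + 1) * n)) := by
        refine Finset.sum_le_sum fun γ hγ => ?_
        gcongr
        exact (hn γ hγ).1
    _ = (∑ γ ∈ s, ‖b γ‖) * Real.exp (-((K + 1) * n)) := (Finset.sum_mul _ _ _).symm
    _ ≤ _ := by
        gcongr
        exact sum_le_tsum_subtype (fun γ => norm_nonneg (b γ)) (hb _) s fun γ hγ => (hn γ hγ).2

theorem summable_norm_div_mul_exp {b : ℝ → ℂ} {c : ℝ} (hc : 0 ≤ c)
    (hs : Summable fun γ : ℝ => ‖b γ‖ * Real.exp (-(c * |γ|)))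
    (hneig : Summable fun γ : {γ : ℝ // 0 < |γ| ∧ |γ| < 1} => ‖b γ / ((γ : ℝ) : ℂ)‖) :
    Summable fun γ : ℝ => ‖b γ / (γ : ℂ)‖ * Real.exp (-(c * |γ|)) := by
  have h1 : Summable ({γ : ℝ | 0 < |γ| ∧ |γ| < 1}.indicator fun γ => ‖b γ / (γ : ℂ)‖) :=
    summable_subtype_iff_indicator.1 hneig
  refine Summable.of_nonneg_of_le (fun γ => by positivity) (fun γ => ?_) (h1.add hs)
  by_cases h : 0 < |γ| ∧ |γ| < 1
  · rw [Set.indicator_of_mem (by exact h)]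
    refine le_add_of_le_of_nonneg ?_ (by positivity)
    refine mul_le_of_le_one_right (norm_nonneg _) ?_
    rw [Real.exp_le_one_iff]
    have := mul_nonneg hc (abs_nonneg γ)
    linarith
  · rw [Set.indicator_of_notMem (by exact h), zero_add]
    gcongr
    rw [norm_div, Complex.norm_real, Real.norm_eq_abs]
    -- At `γ = 0` the quotient is `0` by convention; elsewhere `|γ| ≥ 1` here, so division only
    -- decreases the norm.
    rcases (abs_nonneg γ).eq_or_lt with h0 | h0
    · rw [← h0, div_zero]; exact norm_nonneg _
    · exact div_le_self (norm_nonneg _) (by by_contra hc; exact h ⟨h0, not_le.1 hc⟩)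

/-! ### The identity between the sum over points and the sum over frequencies. -/

theorem norm_max_mul_exp_le {σ η y γ : ℝ} (hσ : σ = 1 ∨ σ = -1) (hy : η < σ * y) :
    max (σ * γ) 0 * Real.exp (-(2 * Real.pi * γ * y)) ≤
      2 / (2 * Real.pi * (σ * y - η)) * Real.exp (-(2 * Real.pi * η * |γ|)) := by
  have hpi := Real.pi_pos
  have hδ : 0 < 2 * Real.pi * (σ * y - η) := by
    have : 0 < σ * y - η := by linarith
    positivity
  rcases le_or_gt (σ * γ) 0 with h | h
  · rw [max_eq_right h, zero_mul]; positivity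
  · have habs : |γ| = σ * γ := by
      rcases hσ with rfl | rfl
      · rw [one_mul] at h ⊢; exact abs_of_pos h
      · rw [abs_of_neg (by linarith)]; ring
    have hσ2 : σ * σ = 1 := by rcases hσ with rfl | rfl <;> norm_num
    rw [max_eq_left h.le, habs]
    set t := σ * γ with ht
    have e1 : γ * y = t * (σ * y) := by rw [ht]; linear_combination -(γ * y) * hσ2
    have e2 : -(2 * Real.pi * γ * y) =
        -(2 * Real.pi * (σ * y - η)) * t + -(2 * Real.pi * η * t) := by
      linear_combination -2 * Real.pi * e1
    rw [e2, Real.exp_add, ← mul_assoc]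
    gcongr
    refine (mul_exp_neg_le hδ).trans (mul_le_of_le_one_right (by positivity) ?_)
    rw [Real.exp_le_one_iff]
    have := mul_pos hδ h
    linarith

/-- The sign `σ` selects the half-plane: after `t ↦ σt` both cases become the same one-sided Laplace
transform. -/
theorem cFourierFun_truncatedRamp {σ : ℝ} (hσ : σ = 1 ∨ σ = -1) (N : ℝ) (z w : ℂ) :
    cFourierFun (fun t => (truncatedRamp N (σ * t) : ℂ) * cexp (2 * Real.pi * I * t * z)) w =
      ∫ t : ℝ, (truncatedRamp N t : ℂ) * cexp (2 * Real.pi * I * σ * (z - w) * t) := by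
  have h0 : cFourierFun (fun t => (truncatedRamp N (σ * t) : ℂ) *
      cexp (2 * Real.pi * I * t * z)) w =
      ∫ t : ℝ, (truncatedRamp N (σ * t) : ℂ) * cexp (2 * Real.pi * I * (z - w) * t) := by
    rw [cFourierFun]
    congr 1
    ext t
    rw [mul_assoc, ← Complex.exp_add]
    congr 2
    ring
  rw [h0]
  rcases hσ with rfl | rfl
  · simp
  · rw [← integral_neg_eq_self]
    congr 1
    ext t
    push_cast
    congr 2
    · simp
    · ring

/-- The function `max (σt) 0 · e^{2πitz}` is neither smooth nor compactly supported, so the Fourier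
hypothesis is applied to its truncations. Dominated convergence on both sides gives the limit: over
the points by the uniform `C/‖s‖²` bound, over the frequencies by the weighted summability of `b`.
-/
theorem tsum_inv_sq_eq {H : ℝ} {A : ℂ → ℕ} (hA : IsStripMultiset H A) {p : ℂ}
    (hs : Summable fun i : Σ z : ℂ, Fin (A z) => (‖i.1 - p‖ ^ 2)⁻¹)
    (hp : ∀ i : Σ z : ℂ, Fin (A z), i.1 ≠ p)
    {b : ℝ → ℂ} (hb : CFourierIsPurePoint (countingMeasure A) b) {η : ℝ}
    (hbs : Summable fun γ : ℝ => ‖b γ‖ * Real.exp (-(2 * Real.pi * η * |γ|)))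
    {σ : ℝ} (hσ : σ = 1 ∨ σ = -1) {z : ℂ} (hz : H < σ * z.im) (hz' : η < σ * z.im) :
    ∑' i : Σ z : ℂ, Fin (A z), ((z - i.1) ^ 2)⁻¹ =
      -4 * Real.pi ^ 2 *
        ∑' γ : ℝ, b γ * ((max (σ * γ) 0 : ℝ) : ℂ) * cexp (2 * Real.pi * I * γ * z) := by
  have hpi := Real.pi_pos
  set φ : ℕ → ℝ → ℂ := fun n t =>
    (truncatedRamp (n + 1) (σ * t) : ℂ) * cexp (2 * Real.pi * I * t * z) with hφ
  have hσ2 : σ * σ = 1 := by rcases hσ with rfl | rfl <;> norm_num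
  have hσ0 : σ ≠ 0 := by rintro rfl; simp at hσ2
  have hσa : |σ| = 1 := by rcases hσ with rfl | rfl <;> norm_num
  have hφsm : ∀ n, ContDiff ℝ ∞ (φ n) := fun n => by
    refine ContDiff.mul ?_ ?_
    · exact Complex.ofRealCLM.contDiff.comp
        ((contDiff_truncatedRamp _).comp (contDiff_const.mul contDiff_id))
    · exact ((contDiff_const.mul Complex.ofRealCLM.contDiff).mul contDiff_const).cexp
  have hφc : ∀ n, HasCompactSupport (φ n) := fun n => by
    have h1 : HasCompactSupport fun t : ℝ => truncatedRamp (n + 1) (σ * t) :=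
      (hasCompactSupport_truncatedRamp (by positivity)).comp_homeomorph (Homeomorph.mulLeft₀ σ hσ0)
    exact (h1.comp_left (g := ((↑) : ℝ → ℂ)) Complex.ofReal_zero).mul_right
  -- geometry of the strip
  set d := σ * z.im - H with hd
  have hdpos : 0 < d := by rw [hd]; linarith
  have him : ∀ i : Σ z : ℂ, Fin (A z), d ≤ σ * (z - i.1).im := fun i => by
    have h1 := hA.abs_im_le i.1 fun h => by have := i.2.2; omega
    have h2 : σ * i.1.im ≤ H := (le_abs_self _).trans (by rw [abs_mul, hσa, one_mul]; exact h1)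
    rw [Complex.sub_im, mul_sub, hd]
    linarith
  have hdist : ∀ i : Σ z : ℂ, Fin (A z), d ≤ ‖z - i.1‖ := fun i => by
    refine (him i).trans ((le_abs_self _).trans ?_)
    rw [abs_mul, hσa, one_mul]
    exact Complex.abs_im_le_norm _
  have hre : ∀ i : Σ z : ℂ, Fin (A z), (2 * Real.pi * I * σ * (z - i.1)).re < 0 := fun i => by
    have : (2 * Real.pi * I * σ * (z - i.1)).re = -(2 * Real.pi * (σ * (z - i.1).im)) := by
      simp; ring
    rw [this, neg_lt_zero]
    have := hdpos.trans_le (him i)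
    positivity
  have hnorm : ∀ i : Σ z : ℂ, Fin (A z), ‖2 * Real.pi * I * σ * (z - i.1)‖ ^ 2 =
      4 * Real.pi ^ 2 * ‖z - i.1‖ ^ 2 := fun i => by
    rw [norm_mul, norm_mul, norm_mul, norm_mul, Complex.norm_I, Complex.norm_real, Complex.norm_real,
      Real.norm_eq_abs σ, hσa, Real.norm_of_nonneg hpi.le, Complex.norm_ofNat]
    ring
  obtain ⟨C, hC0, hC⟩ := exists_norm_integral_truncatedRamp_mul_cexp_le
  set M := 1 + ‖z - p‖ / d with hM
  have hbound : ∀ (n : ℕ) (i : Σ z : ℂ, Fin (A z)),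
      ‖cFourierFun (φ n) i.1‖ ≤ C * (4 * Real.pi ^ 2)⁻¹ * M ^ 2 * (‖i.1 - p‖ ^ 2)⁻¹ := by
    intro n i
    rw [hφ, cFourierFun_truncatedRamp hσ]
    refine (hC _ (by positivity) _ (hre i)).trans ?_
    rw [hnorm, mul_inv]
    have h1 := inv_norm_sub_le hdpos (hp i) (hdist i) le_rfl
    have h2 : (‖z - i.1‖ ^ 2)⁻¹ ≤ M ^ 2 * (‖i.1 - p‖ ^ 2)⁻¹ := by
      rw [← inv_pow, ← inv_pow, ← mul_pow]
      gcongr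
    calc C * ((4 * Real.pi ^ 2)⁻¹ * (‖z - i.1‖ ^ 2)⁻¹)
        ≤ C * ((4 * Real.pi ^ 2)⁻¹ * (M ^ 2 * (‖i.1 - p‖ ^ 2)⁻¹)) := by gcongr
      _ = _ := by ring
  have hsum := hs.mul_left (C * (4 * Real.pi ^ 2)⁻¹ * M ^ 2)
  have hL : Tendsto (fun n => cFourier (countingMeasure A) (φ n)) atTop
      (nhds (∑' i : Σ z : ℂ, Fin (A z), ((2 * Real.pi * I * σ * (z - i.1)) ^ 2)⁻¹)) := by
    have h1 : ∀ n, cFourier (countingMeasure A) (φ n) =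
        ∑' i : Σ z : ℂ, Fin (A z), cFourierFun (φ n) i.1 := fun n =>
      integral_countingMeasure hA.locFinite
        (Summable.of_nonneg_of_le (fun _ => norm_nonneg _) (hbound n) hsum)
    simp only [h1]
    refine tendsto_tsum_of_dominated_convergence hsum (fun i => ?_)
      (Eventually.of_forall fun n i => hbound n i)
    simp only [hφ, cFourierFun_truncatedRamp hσ]
    exact tendsto_integral_truncatedRamp_mul_cexp (hre i)
  have hexp : ∀ γ : ℝ, ‖cexp (2 * Real.pi * I * γ * z)‖ =
      Real.exp (-(2 * Real.pi * γ * z.im)) := fun γ => by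
    rw [Complex.norm_exp]; congr 1; simp
  have hR : Tendsto (fun n => ∑' γ : ℝ, b γ * φ n γ) atTop
      (nhds (∑' γ : ℝ, b γ * ((max (σ * γ) 0 : ℝ) : ℂ) * cexp (2 * Real.pi * I * γ * z))) := by
    refine tendsto_tsum_of_dominated_convergence
      (hbs.mul_left (2 / (2 * Real.pi * (σ * z.im - η)))) (fun γ => ?_)
      (Eventually.of_forall fun n γ => ?_)
    · simp only [hφ, mul_assoc (b γ)]
      exact (((Complex.continuous_ofReal.tendsto _).comp
        (tendsto_truncatedRamp (σ * γ))).mul_const _).const_mul _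
    · rw [hφ, norm_mul, norm_mul, hexp, Complex.norm_real, Real.norm_eq_abs]
      calc ‖b γ‖ * (|truncatedRamp (n + 1) (σ * γ)| * Real.exp (-(2 * Real.pi * γ * z.im)))
          ≤ ‖b γ‖ * (max (σ * γ) 0 * Real.exp (-(2 * Real.pi * γ * z.im))) := by
            gcongr
            exact abs_truncatedRamp_le (by positivity) _
        _ ≤ ‖b γ‖ * (2 / (2 * Real.pi * (σ * z.im - η)) *
              Real.exp (-(2 * Real.pi * η * |γ|))) := by
            exact mul_le_mul_of_nonneg_left (norm_max_mul_exp_le hσ hz') (norm_nonneg _)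
        _ = _ := by ring
  simp only [fun n => (hb.hasSum (φ n) (hφsm n) (hφc n)).tsum_eq] at hR
  rw [tendsto_nhds_unique hR hL, ← tsum_mul_left]
  refine tsum_congr fun i => ?_
  have h1 : (2 * Real.pi * I * σ * (z - i.1)) ^ 2 =
      -4 * (Real.pi : ℂ) ^ 2 * (z - i.1) ^ 2 := by
    have : (σ : ℂ) * σ = 1 := by exact_mod_cast hσ2
    linear_combination (4 * (Real.pi : ℂ) ^ 2 * (z - i.1) ^ 2 * (σ : ℂ) ^ 2) * Complex.I_sq -
      4 * (Real.pi : ℂ) ^ 2 * (z - i.1) ^ 2 * this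
  have h2 : (-4 * (Real.pi : ℂ) ^ 2) ≠ 0 :=
    mul_ne_zero (by norm_num) (pow_ne_zero 2 (Complex.ofReal_ne_zero.2 hpi.ne'))
  rw [h1, mul_inv, mul_inv_cancel_left₀ h2]

/-! ### Termwise differentiation and decay of Dirichlet series. -/

theorem norm_cexp_two_pi_I (s : ℝ) (z : ℂ) :
    ‖cexp (2 * Real.pi * I * s * z)‖ = Real.exp (-(2 * Real.pi * s * z.im)) := by
  rw [Complex.norm_exp]; congr 1; simp

section TermwiseDerivative

variable {q : ℝ → ℂ} {u : ℝ → ℝ} {U : Set ℂ}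

theorem differentiableOn_dirichletSeries (hu : Summable u) (hU : IsOpen U)
    (h : ∀ s, ∀ z ∈ U, ‖q s * cexp (2 * Real.pi * I * s * z)‖ ≤ u s) :
    DifferentiableOn ℂ (dirichletSeries q) U :=
  Complex.differentiableOn_tsum_of_summable_norm hu
    (fun s => (by fun_prop : Differentiable ℂ _).differentiableOn) hU h

theorem hasDerivAt_dirichletSeries (hu : Summable u) (hU : IsOpen U)
    (h : ∀ s, ∀ z ∈ U, ‖q s * cexp (2 * Real.pi * I * s * z)‖ ≤ u s) {z : ℂ} (hz : z ∈ U) :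
    HasDerivAt (dirichletSeries q) (dirichletSeries (fun s => 2 * Real.pi * I * s * q s) z) z := by
  have h1 := ((differentiableOn_dirichletSeries hu hU h).differentiableAt
    (hU.mem_nhds hz)).hasDerivAt
  have h2 := Complex.hasSum_deriv_of_summable_norm hu
    (fun s => (by fun_prop : Differentiable ℂ _).differentiableOn) hU h hz
  refine h1.congr_deriv (h2.tsum_eq.symm.trans (tsum_congr fun s => ?_))
  have h3 : HasDerivAt (fun z : ℂ => 2 * Real.pi * I * s * z) (2 * Real.pi * I * s * 1) z :=
    (hasDerivAt_id z).const_mul _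
  rw [(h3.cexp.const_mul (q s)).deriv]
  ring

end TermwiseDerivative

theorem norm_dirichletTerm_le {q : ℝ → ℂ} (hq : ∀ s < 0, q s = 0) {η : ℝ} {z : ℂ}
    (hz : η ≤ z.im) (s : ℝ) :
    ‖q s * cexp (2 * Real.pi * I * s * z)‖ ≤ ‖q s‖ * Real.exp (-(2 * Real.pi * s * η)) := by
  rcases lt_or_ge s 0 with hs | hs
  · simp [hq s hs]
  · rw [norm_mul, norm_cexp_two_pi_I]
    have := Real.pi_pos
    gcongr

theorem hasDerivAt_dirichletSeries_of_nonneg {q : ℝ → ℂ} (hq : ∀ s < 0, q s = 0) {η : ℝ}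
    (hs : Summable fun s => ‖q s‖ * Real.exp (-(2 * Real.pi * s * η))) {z : ℂ} (hz : η < z.im) :
    HasDerivAt (dirichletSeries q) (dirichletSeries (fun s => 2 * Real.pi * I * s * q s) z) z :=
  hasDerivAt_dirichletSeries hs (Complex.isOpen_im_gt η)
    (fun s _ hz => norm_dirichletTerm_le hq (le_of_lt hz) s) hz

/-- Raising the height from `η` to `η'` gains a factor `e^{-2π(η'-η)s}`, which absorbs the factor
`s` produced by differentiation. -/
theorem summable_deriv_coeff {q : ℝ → ℂ} (hq : ∀ s < 0, q s = 0) {η η' : ℝ} (hη : η < η')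
    (hs : Summable fun s => ‖q s‖ * Real.exp (-(2 * Real.pi * s * η))) :
    Summable fun s : ℝ =>
      ‖2 * Real.pi * I * s * q s‖ * Real.exp (-(2 * Real.pi * s * η')) := by
  have hpi := Real.pi_pos
  have hδ : 0 < 2 * Real.pi * (η' - η) := by
    have := sub_pos.2 hη
    positivity
  refine Summable.of_nonneg_of_le (fun s => by positivity) (fun s => ?_)
    (hs.mul_left (2 * Real.pi * (2 / (2 * Real.pi * (η' - η)))))
  rcases lt_or_ge s 0 with hs | hs
  · simp [hq s hs]
  · have h1 : s * Real.exp (-(2 * Real.pi * (η' - η)) * s) ≤ 2 / (2 * Real.pi * (η' - η)) := by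
      refine (mul_exp_neg_le hδ).trans (mul_le_of_le_one_right (by positivity) ?_)
      rw [Real.exp_le_one_iff]
      have := mul_nonneg hδ.le hs
      linarith
    have h2 : Real.exp (-(2 * Real.pi * s * η')) =
        Real.exp (-(2 * Real.pi * (η' - η)) * s) * Real.exp (-(2 * Real.pi * s * η)) := by
      rw [← Real.exp_add]; congr 1; ring
    rw [norm_mul, norm_mul, norm_mul, norm_mul, Complex.norm_I, Complex.norm_real,
      Complex.norm_real, Real.norm_of_nonneg hs, Real.norm_of_nonneg hpi.le, Complex.norm_ofNat, h2]
    calc 2 * Real.pi * 1 * s * ‖q s‖ *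
          (Real.exp (-(2 * Real.pi * (η' - η)) * s) * Real.exp (-(2 * Real.pi * s * η)))
        = 2 * Real.pi * (s * Real.exp (-(2 * Real.pi * (η' - η)) * s)) *
          (‖q s‖ * Real.exp (-(2 * Real.pi * s * η))) := by ring
      _ ≤ _ := by gcongr

theorem tendsto_dirichletSeries_atTop {q : ℝ → ℂ} (hq : ∀ s ≤ 0, q s = 0) {η : ℝ}
    (hs : Summable fun s => ‖q s‖ * Real.exp (-(2 * Real.pi * s * η))) :
    Tendsto (fun y : ℝ => dirichletSeries q (y * I)) atTop (nhds 0) := by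
  have h0 : (0 : ℂ) = ∑' _ : ℝ, (0 : ℂ) := tsum_zero.symm
  rw [h0]
  refine tendsto_tsum_of_dominated_convergence hs (fun s => ?_) ?_
  · rcases le_or_gt s 0 with h | h
    · simp [hq s h]
    · rw [tendsto_zero_iff_norm_tendsto_zero]
      simp only [norm_mul, norm_cexp_two_pi_I]
      have h1 : Tendsto (fun y : ℝ => Real.exp (-(2 * Real.pi * s) * y)) atTop (nhds 0) :=
        Real.tendsto_exp_atBot.comp (tendsto_id.const_mul_atTop_of_neg (by
          have := Real.pi_pos
          have : 0 < 2 * Real.pi * s := by positivity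
          linarith))
      have h2 := h1.const_mul ‖q s‖
      rw [mul_zero] at h2
      refine h2.congr fun y => ?_
      simp
  · filter_upwards [eventually_ge_atTop η] with y hy s
    exact norm_dirichletTerm_le (fun s hs => hq s hs.le) (by simpa using hy) s

/-! ### Exponentials in a weighted ℓ¹ convolution algebra. -/

/-- Convolution of two functions on the discrete group of real numbers. -/
def discreteConvolution (p q : ℝ → ℂ) (s : ℝ) : ℂ := ∑' t, p t * q (s - t)

/-- Powers for the convolution on the discrete group of real numbers. -/
def convolutionPow (q : ℝ → ℂ) : ℕ → ℝ → ℂ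
  | 0 => Pi.single 0 1
  | n + 1 => discreteConvolution q (convolutionPow q n)

/-- The exponential for the convolution on the discrete group of real numbers. -/
def convolutionExp (q : ℝ → ℂ) (s : ℝ) : ℂ := ∑' n : ℕ, ((n.factorial : ℂ))⁻¹ * convolutionPow q n s

section Convolution

/-- The map `(s, t) ↦ (t, s - t)`. -/
def convolutionEquiv : ℝ × ℝ ≃ ℝ × ℝ where
  toFun x := (x.2, x.1 - x.2)
  invFun x := (x.1 + x.2, x.1)
  left_inv x := by simp
  right_inv x := by simp

variable {w : ℝ → ℝ} {p q : ℝ → ℂ}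

/-- A multiplicative weight turns the weighted double sum, via `(s, t) ↦ (t, s - t)`, into a product
of two weighted sums; this makes the weighted ℓ¹ space an algebra. -/
theorem summable_convolution_prod (hw0 : ∀ s, 0 < w s) (hw : ∀ s t, w (s + t) = w s * w t)
    (hp : Summable fun s => ‖p s‖ * w s) (hq : Summable fun s => ‖q s‖ * w s) :
    Summable fun x : ℝ × ℝ => ‖p x.2 * q (x.1 - x.2)‖ * w x.1 := by
  have h := (hp.mul_of_nonneg hq (fun s => mul_nonneg (norm_nonneg _) (hw0 s).le)
    (fun s => mul_nonneg (norm_nonneg _) (hw0 s).le))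
  refine (convolutionEquiv.summable_iff.2 h).congr fun x => ?_
  have : w x.1 = w x.2 * w (x.1 - x.2) := by rw [← hw, add_sub_cancel]
  simp only [convolutionEquiv, Equiv.coe_fn_mk, Function.comp, this, norm_mul]
  ring

theorem summable_convolution_fiber (hw0 : ∀ s, 0 < w s) (hw : ∀ s t, w (s + t) = w s * w t)
    (hp : Summable fun s => ‖p s‖ * w s) (hq : Summable fun s => ‖q s‖ * w s) (s : ℝ) :
    Summable fun t => ‖p t * q (s - t)‖ := by
  have h := (summable_convolution_prod hw0 hw hp hq).prod_factor s
  exact (summable_mul_right_iff (hw0 s).ne').1 h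

theorem norm_discreteConvolution_mul_le (hw0 : ∀ s, 0 < w s)
    (hw : ∀ s t, w (s + t) = w s * w t)
    (hp : Summable fun s => ‖p s‖ * w s) (hq : Summable fun s => ‖q s‖ * w s) (s : ℝ) :
    ‖discreteConvolution p q s‖ * w s ≤ ∑' t, ‖p t * q (s - t)‖ * w s := by
  rw [tsum_mul_right]
  exact mul_le_mul_of_nonneg_right
    (norm_tsum_le_tsum_norm (summable_convolution_fiber hw0 hw hp hq s)) (hw0 s).le

theorem summable_discreteConvolution (hw0 : ∀ s, 0 < w s) (hw : ∀ s t, w (s + t) = w s * w t)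
    (hp : Summable fun s => ‖p s‖ * w s) (hq : Summable fun s => ‖q s‖ * w s) :
    Summable fun s => ‖discreteConvolution p q s‖ * w s :=
  Summable.of_nonneg_of_le (fun s => mul_nonneg (norm_nonneg _) (hw0 s).le)
    (norm_discreteConvolution_mul_le hw0 hw hp hq) (summable_convolution_prod hw0 hw hp hq).prod

theorem tsum_discreteConvolution_le (hw0 : ∀ s, 0 < w s) (hw : ∀ s t, w (s + t) = w s * w t)
    (hp : Summable fun s => ‖p s‖ * w s) (hq : Summable fun s => ‖q s‖ * w s) :
    ∑' s, ‖discreteConvolution p q s‖ * w s ≤ (∑' s, ‖p s‖ * w s) * ∑' s, ‖q s‖ * w s := by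
  have h := (summable_convolution_prod hw0 hw hp hq)
  refine ((summable_discreteConvolution hw0 hw hp hq).tsum_le_tsum
    (norm_discreteConvolution_mul_le hw0 hw hp hq) h.prod).trans_eq ?_
  rw [← h.tsum_prod, tsum_mul_tsum_of_summable_norm hp.norm hq.norm,
    ← convolutionEquiv.tsum_eq fun x : ℝ × ℝ => ‖p x.1‖ * w x.1 * (‖q x.2‖ * w x.2)]
  refine tsum_congr fun x => ?_
  have : w x.1 = w x.2 * w (x.1 - x.2) := by rw [← hw, add_sub_cancel]
  simp only [convolutionEquiv, Equiv.coe_fn_mk, this, norm_mul]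
  ring

variable {S : AddSubmonoid ℝ} {χ : ℝ → ℂ}

theorem discreteConvolution_eq_zero (hp : ∀ s ∉ S, p s = 0) (hq : ∀ s ∉ S, q s = 0) :
    ∀ s ∉ S, discreteConvolution p q s = 0 := by
  intro s hs
  rw [discreteConvolution, ← tsum_zero (β := ℝ)]
  refine tsum_congr fun t => ?_
  by_cases ht : t ∈ S
  · rw [hq (s - t) fun h => hs (by simpa using S.add_mem ht h), mul_zero]
  · rw [hp t ht, zero_mul]

theorem norm_mul_character_le (hpS : ∀ s ∉ S, p s = 0) (hχw : ∀ s ∈ S, ‖χ s‖ ≤ w s)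
    (s : ℝ) : ‖p s * χ s‖ ≤ ‖p s‖ * w s := by
  by_cases hs : s ∈ S
  · rw [norm_mul]; exact mul_le_mul_of_nonneg_left (hχw s hs) (norm_nonneg _)
  · simp [hpS s hs]

/-- A character `χ` gives a multiplicative functional on the algebra. Domination by `w` is available
only on the submonoid `S`, whence the support conditions: `e^{2πisz}` with `Im z ≥ η` is dominated
by `e^{-2πsη}` only for `s ≥ 0`. -/
theorem tsum_discreteConvolution_mul
    (hp : Summable fun s => ‖p s‖ * w s) (hq : Summable fun s => ‖q s‖ * w s)
    (hpS : ∀ s ∉ S, p s = 0) (hqS : ∀ s ∉ S, q s = 0)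
    (hχ : ∀ s t, χ (s + t) = χ s * χ t) (hχw : ∀ s ∈ S, ‖χ s‖ ≤ w s) :
    ∑' s, discreteConvolution p q s * χ s = (∑' s, p s * χ s) * ∑' s, q s * χ s := by
  have hp' := Summable.of_nonneg_of_le (fun s => norm_nonneg _)
    (norm_mul_character_le hpS hχw) hp
  have hq' := Summable.of_nonneg_of_le (fun s => norm_nonneg _)
    (norm_mul_character_le hqS hχw) hq
  have key : ∀ x : ℝ × ℝ, p x.2 * χ x.2 * (q (x.1 - x.2) * χ (x.1 - x.2)) =
      p x.2 * q (x.1 - x.2) * χ x.1 := fun x => by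
    have : χ x.1 = χ x.2 * χ (x.1 - x.2) := by rw [← hχ, add_sub_cancel]
    rw [this]; ring
  have hsum : Summable fun x : ℝ × ℝ => p x.2 * q (x.1 - x.2) * χ x.1 := by
    refine (convolutionEquiv.summable_iff.2
      (summable_mul_of_summable_norm hp' hq')).congr fun x => ?_
    exact key x
  rw [tsum_mul_tsum_of_summable_norm hp' hq', ← convolutionEquiv.tsum_eq]
  simp only [convolutionEquiv, Equiv.coe_fn_mk, key]
  rw [hsum.tsum_prod]
  refine tsum_congr fun s => ?_
  exact tsum_mul_right.symm

theorem convolutionPow_eq_zero (hqS : ∀ s ∉ S, q s = 0) (n : ℕ) :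
    ∀ s ∉ S, convolutionPow q n s = 0 := by
  induction n with
  | zero => intro s hs; exact Pi.single_eq_of_ne (by rintro rfl; exact hs S.zero_mem) 1
  | succ n ih => exact discreteConvolution_eq_zero hqS ih

theorem single_zero_one_mul (f : ℝ → ℝ) (s : ℝ) :
    ‖(Pi.single 0 1 : ℝ → ℂ) s‖ * f s = (Pi.single 0 (f 0) : ℝ → ℝ) s := by
  rcases eq_or_ne s 0 with rfl | h
  · simp
  · simp [h]

theorem summable_convolutionPow (hw0 : ∀ s, 0 < w s) (hw : ∀ s t, w (s + t) = w s * w t)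
    (hq : Summable fun s => ‖q s‖ * w s) (n : ℕ) :
    Summable fun s => ‖convolutionPow q n s‖ * w s := by
  induction n with
  | zero =>
    simp only [convolutionPow, single_zero_one_mul]
    exact (hasSum_pi_single 0 _).summable
  | succ n ih => exact summable_discreteConvolution hw0 hw hq ih

theorem tsum_convolutionPow_le (hw0 : ∀ s, 0 < w s) (hw : ∀ s t, w (s + t) = w s * w t)
    (hq : Summable fun s => ‖q s‖ * w s) (n : ℕ) :
    ∑' s, ‖convolutionPow q n s‖ * w s ≤ (∑' s, ‖q s‖ * w s) ^ n := by
  induction n with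
  | zero =>
    have h1 : w 0 = 1 := by
      have := hw 0 0
      rw [add_zero] at this
      exact (mul_eq_left₀ (hw0 0).ne').1 this.symm
    simp only [convolutionPow, single_zero_one_mul]
    rw [(hasSum_pi_single 0 _).tsum_eq, h1, pow_zero]
  | succ n ih =>
    refine (tsum_discreteConvolution_le hw0 hw hq (summable_convolutionPow hw0 hw hq n)).trans ?_
    rw [pow_succ']
    exact mul_le_mul_of_nonneg_left ih (tsum_nonneg fun s => mul_nonneg (norm_nonneg _) (hw0 s).le)

theorem tsum_convolutionPow_mul (hw0 : ∀ s, 0 < w s) (hw : ∀ s t, w (s + t) = w s * w t)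
    (hq : Summable fun s => ‖q s‖ * w s) (hqS : ∀ s ∉ S, q s = 0) (hχ0 : χ 0 = 1)
    (hχ : ∀ s t, χ (s + t) = χ s * χ t) (hχw : ∀ s ∈ S, ‖χ s‖ ≤ w s) (n : ℕ) :
    ∑' s, convolutionPow q n s * χ s = (∑' s, q s * χ s) ^ n := by
  induction n with
  | zero =>
    rw [tsum_eq_single 0 fun s hs => by simp [convolutionPow, hs], pow_zero]
    simp [convolutionPow, hχ0]
  | succ n ih =>
    rw [pow_succ', ← ih]
    exact tsum_discreteConvolution_mul hq (summable_convolutionPow hw0 hw hq n) hqS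
      (convolutionPow_eq_zero hqS n) hχ hχw

/-- Submultiplicativity of the weighted norm reduces the double sum to the scalar exponential series
of `∑ ‖q s‖ w s`. -/
theorem summable_convolutionExp_prod (hw0 : ∀ s, 0 < w s) (hw : ∀ s t, w (s + t) = w s * w t)
    (hq : Summable fun s => ‖q s‖ * w s) :
    Summable fun x : ℕ × ℝ =>
      ‖((x.1.factorial : ℂ))⁻¹ * convolutionPow q x.1 x.2‖ * w x.2 := by
  have heq : ∀ (n : ℕ) (s : ℝ), ‖((n.factorial : ℂ))⁻¹ * convolutionPow q n s‖ * w s =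
      ((n.factorial : ℝ))⁻¹ * (‖convolutionPow q n s‖ * w s) := fun n s => by
    rw [norm_mul, norm_inv, Complex.norm_natCast, mul_assoc]
  rw [summable_prod_of_nonneg fun x => mul_nonneg (norm_nonneg _) (hw0 _).le]
  simp only [heq]
  refine ⟨fun n => (summable_convolutionPow hw0 hw hq n).mul_left _, ?_⟩
  simp only [tsum_mul_left]
  refine Summable.of_nonneg_of_le (fun n => mul_nonneg (by positivity)
    (tsum_nonneg fun s => mul_nonneg (norm_nonneg _) (hw0 s).le)) (fun n => ?_)
    (Real.summable_pow_div_factorial (∑' s, ‖q s‖ * w s))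
  rw [div_eq_inv_mul]
  exact mul_le_mul_of_nonneg_left (tsum_convolutionPow_le hw0 hw hq n) (by positivity)

theorem convolutionExp_eq_zero (hqS : ∀ s ∉ S, q s = 0) : ∀ s ∉ S, convolutionExp q s = 0 := by
  intro s hs
  simp [convolutionExp, convolutionPow_eq_zero hqS _ s hs]

theorem summable_convolutionExp (hw0 : ∀ s, 0 < w s) (hw : ∀ s t, w (s + t) = w s * w t)
    (hq : Summable fun s => ‖q s‖ * w s) : Summable fun s => ‖convolutionExp q s‖ * w s := by
  have h := (summable_convolutionExp_prod hw0 hw hq).prod_symm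
  refine Summable.of_nonneg_of_le (fun s => mul_nonneg (norm_nonneg _) (hw0 s).le)
    (fun s => ?_) h.prod
  simp only [Prod.swap_prod_mk]
  rw [tsum_mul_right]
  exact mul_le_mul_of_nonneg_right (norm_tsum_le_tsum_norm
    ((summable_mul_right_iff (hw0 s).ne').1 (h.prod_factor s))) (hw0 s).le

theorem tsum_convolutionExp_mul (hw0 : ∀ s, 0 < w s) (hw : ∀ s t, w (s + t) = w s * w t)
    (hq : Summable fun s => ‖q s‖ * w s) (hqS : ∀ s ∉ S, q s = 0) (hχ0 : χ 0 = 1)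
    (hχ : ∀ s t, χ (s + t) = χ s * χ t) (hχw : ∀ s ∈ S, ‖χ s‖ ≤ w s) :
    ∑' s, convolutionExp q s * χ s = cexp (∑' s, q s * χ s) := by
  have hsum : Summable fun x : ℕ × ℝ =>
      ((x.1.factorial : ℂ))⁻¹ * convolutionPow q x.1 x.2 * χ x.2 := by
    refine Summable.of_norm_bounded (summable_convolutionExp_prod hw0 hw hq) fun x => ?_
    exact norm_mul_character_le (p := fun s => ((x.1.factorial : ℂ))⁻¹ * convolutionPow q x.1 s)
      (fun s hs => by simp [convolutionPow_eq_zero hqS _ s hs]) hχw x.2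
  simp only [convolutionExp, ← tsum_mul_right]
  rw [hsum.tsum_comm, Complex.exp_eq_exp_ℂ, NormedSpace.exp_eq_tsum_div]
  refine tsum_congr fun n => ?_
  simp only [mul_assoc]
  rw [tsum_mul_left, tsum_convolutionPow_mul hw0 hw hq hqS hχ0 hχ hχw, div_eq_inv_mul]

end Convolution

theorem dirichletSeries_convolutionExp {q : ℝ → ℂ} {S : AddSubmonoid ℝ}
    (hqS : ∀ s ∉ S, q s = 0) (hS : ∀ s ∈ S, 0 ≤ s) {η : ℝ}
    (hs : Summable fun s => ‖q s‖ * Real.exp (-(2 * Real.pi * s * η))) {z : ℂ} (hz : η ≤ z.im) :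
    dirichletSeries (convolutionExp q) z = cexp (dirichletSeries q z) := by
  have hpi := Real.pi_pos
  refine tsum_convolutionExp_mul (S := S) (w := fun s => Real.exp (-(2 * Real.pi * s * η)))
    (χ := fun s : ℝ => cexp (2 * Real.pi * I * s * z))
    (fun s => Real.exp_pos _) (fun s t => ?_) hs hqS (by simp) (fun s t => ?_) fun s hs => ?_
  · rw [← Real.exp_add]; congr 1; ring
  · rw [← Complex.exp_add]; congr 1; push_cast; ring
  · rw [norm_cexp_two_pi_I]
    have := hS s hs
    gcongr

theorem summable_convolutionExp_mul_exp {q : ℝ → ℂ} {η : ℝ}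
    (hs : Summable fun s => ‖q s‖ * Real.exp (-(2 * Real.pi * s * η))) :
    Summable fun s => ‖convolutionExp q s‖ * Real.exp (-(2 * Real.pi * s * η)) :=
  summable_convolutionExp (fun s => Real.exp_pos _)
    (fun s t => by rw [← Real.exp_add]; congr 1; ring) hs

/-! ### Bohr means, Phragmén–Lindelöf and comparison of coefficients on two lines. -/

theorem tendsto_mean_exp (ν s : ℝ) (η : ℝ) :
    Tendsto (fun T : ℝ => (T : ℂ)⁻¹ * ∫ x in (0 : ℝ)..T,
      cexp (2 * Real.pi * I * ((s - ν : ℝ) : ℂ) * (x + η * I))) atTop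
      (nhds (if s = ν then 1 else 0)) := by
  split_ifs with h
  · subst h
    refine tendsto_const_nhds.congr' ?_
    filter_upwards [eventually_gt_atTop 0] with T hT
    have : (T : ℂ) ≠ 0 := Complex.ofReal_ne_zero.2 hT.ne'
    simp [this]
  · set c : ℂ := 2 * Real.pi * I * ((s - ν : ℝ) : ℂ) with hc
    have hc0 : c ≠ 0 := by
      rw [hc]
      exact mul_ne_zero Complex.two_pi_I_ne_zero (Complex.ofReal_ne_zero.2 (sub_ne_zero.2 h))
    have hnorm : ∀ T : ℝ, ‖cexp (c * T)‖ = 1 := fun T => by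
      rw [Complex.norm_exp, hc]; simp
    rw [tendsto_zero_iff_norm_tendsto_zero]
    have hlim : Tendsto (fun T : ℝ => T⁻¹ * (‖cexp (c * (η * I))‖ * (2 / ‖c‖))) atTop (nhds 0) := by
      simpa only [zero_mul] using (tendsto_inv_atTop_zero (𝕜 := ℝ)).mul_const _
    refine squeeze_zero' (Eventually.of_forall fun _ => norm_nonneg _) ?_ hlim
    filter_upwards [eventually_gt_atTop 0] with T hT
    have h1 : ∫ x in (0 : ℝ)..T, cexp (c * (x + η * I)) =
        cexp (c * (η * I)) * ((cexp (c * T) - cexp (c * (0 : ℝ))) / c) := by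
      rw [← integral_exp_mul_complex hc0, ← intervalIntegral.integral_const_mul]
      congr 1
      ext x
      rw [← Complex.exp_add]
      congr 1
      ring
    rw [h1, norm_mul, norm_mul, norm_inv, Complex.norm_real, Real.norm_of_nonneg hT.le, norm_div]
    gcongr
    refine (norm_sub_le _ _).trans ?_
    rw [hnorm, hnorm]
    norm_num

theorem tendsto_mean_dirichletSeries {p : ℝ → ℂ} {η : ℝ}
    (hp : Summable fun s => ‖p s‖ * Real.exp (-(2 * Real.pi * s * η))) (ν : ℝ) :
    Tendsto (fun T : ℝ => (T : ℂ)⁻¹ * ∫ x in (0 : ℝ)..T, dirichletSeries p (x + η * I) *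
      cexp (-(2 * Real.pi * I * ν * (x + η * I)))) atTop (nhds (p ν)) := by
  -- The index set is cut down to the support because dominated convergence for the integral of a
  -- series needs a countable one.
  have hcount : (Function.support p).Countable := by
    refine hp.countable_support.mono fun s hs => ?_
    exact mul_ne_zero (norm_ne_zero_iff.2 hs) (Real.exp_pos _).ne'
  have : Countable (Function.support p) := hcount
  set W := Real.exp (2 * Real.pi * ν * η)
  have hb : Summable fun s => ‖p s‖ * Real.exp (-(2 * Real.pi * s * η)) * W := hp.mul_right W
  have hterm : ∀ s x : ℝ, ‖p s * cexp (2 * Real.pi * I * ((s - ν : ℝ) : ℂ) * (x + η * I))‖ =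
      ‖p s‖ * Real.exp (-(2 * Real.pi * s * η)) * W := fun s x => by
    rw [norm_mul, norm_cexp_two_pi_I, mul_assoc ‖p s‖, ← Real.exp_add]
    congr 2
    simp
    ring
  have hsum : ∀ x : ℝ, HasSum
      (fun s : Function.support p =>
        p s * cexp (2 * Real.pi * I * ((s - ν : ℝ) : ℂ) * (x + η * I)))
      (dirichletSeries p (x + η * I) * cexp (-(2 * Real.pi * I * ν * (x + η * I)))) := by
    intro x
    have h1 : Summable fun s =>
        p s * cexp (2 * Real.pi * I * ((s - ν : ℝ) : ℂ) * (x + η * I)) :=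
      Summable.of_norm (by simpa only [hterm] using hb)
    have h2 : ∑' s, p s * cexp (2 * Real.pi * I * ((s - ν : ℝ) : ℂ) * (x + η * I)) =
        dirichletSeries p (x + η * I) * cexp (-(2 * Real.pi * I * ν * (x + η * I))) := by
      rw [dirichletSeries, ← tsum_mul_right]
      refine tsum_congr fun s => ?_
      rw [mul_assoc (p s), ← Complex.exp_add]
      congr 2
      push_cast
      ring
    have h3 := h1.hasSum
    rw [h2] at h3
    refine (hasSum_subtype_iff_of_support_subset (f := fun s : ℝ =>
      p s * cexp (2 * Real.pi * I * ((s - ν : ℝ) : ℂ) * (x + η * I))) ?_).2 h3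
    intro s hs h0
    exact hs (by simp [h0])
  have hint : ∀ T : ℝ, ∫ x in (0 : ℝ)..T, dirichletSeries p (x + η * I) *
      cexp (-(2 * Real.pi * I * ν * (x + η * I))) =
      ∑' s, p s * ∫ x in (0 : ℝ)..T,
        cexp (2 * Real.pi * I * ((s - ν : ℝ) : ℂ) * (x + η * I)) := by
    intro T
    have h1 := intervalIntegral.hasSum_integral_of_dominated_convergence (μ := volume)
      (a := 0) (b := T)
      (F := fun (s : Function.support p) (x : ℝ) =>
        p s * cexp (2 * Real.pi * I * ((s - ν : ℝ) : ℂ) * (x + η * I)))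
      (fun s _ => ‖p s‖ * Real.exp (-(2 * Real.pi * s * η)) * W)
      (fun s => (by fun_prop : Continuous _).aestronglyMeasurable)
      (fun s => Eventually.of_forall fun x _ => (hterm s x).le)
      (Eventually.of_forall fun x _ => hb.subtype _)
      (by simp) (Eventually.of_forall fun x _ => hsum x)
    rw [← h1.tsum_eq]
    simp only [intervalIntegral.integral_const_mul]
    refine tsum_subtype_eq_of_support_subset (f := fun s : ℝ => p s * ∫ x in (0 : ℝ)..T,
        cexp (2 * Real.pi * I * ((s - ν : ℝ) : ℂ) * (x + η * I))) ?_
    intro s hs h0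
    exact hs (by simp [h0])
  simp only [hint, ← tsum_mul_left]
  have hlim : p ν = ∑' s, p s * (if s = ν then 1 else 0) := by simp
  rw [hlim]
  refine tendsto_tsum_of_dominated_convergence hb (fun s => ?_) ?_
  · refine ((tendsto_mean_exp ν s η).const_mul (p s)).congr fun T => ?_
    ring
  · filter_upwards [eventually_gt_atTop 0] with T hT s
    have h1 : ‖∫ x in (0 : ℝ)..T, p s *
        cexp (2 * Real.pi * I * ((s - ν : ℝ) : ℂ) * (x + η * I))‖ ≤
        ‖p s‖ * Real.exp (-(2 * Real.pi * s * η)) * W * |T - 0| :=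
      intervalIntegral.norm_integral_le_of_norm_le_const fun x _ => (hterm s x).le
    rw [intervalIntegral.integral_const_mul, sub_zero, abs_of_pos hT] at h1
    rw [norm_mul, norm_inv, Complex.norm_real, Real.norm_of_nonneg hT.le]
    calc _ ≤ T⁻¹ * (‖p s‖ * Real.exp (-(2 * Real.pi * s * η)) * W * T) := by gcongr
      _ = _ := by field_simp

theorem norm_le_of_norm_le_on_strip_boundary {F : ℂ → ℂ} (hF : Differentiable ℂ F) {B : ℝ}
    (hB : 0 ≤ B) (hgrowth : ∀ z, ‖F z‖ ≤ Real.exp (B * (1 + ‖z‖ ^ 2))) {η : ℝ} (hη : 0 < η) {M : ℝ}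
    (hu : ∀ z : ℂ, z.im = η → ‖F z‖ ≤ M) (hl : ∀ z : ℂ, z.im = -η → ‖F z‖ ≤ M) {z : ℂ}
    (h1 : -η ≤ z.im) (h2 : z.im ≤ η) : ‖F z‖ ≤ M := by
  -- The strip has width `2η`, so any exponent below `π / (2η)` is admissible; `t² ≤ 2eᵗ` then puts
  -- quadratic growth under `exp (B' e^{c|Re z|})`.
  set c := 1 / (2 * η) with hc
  have hcpos : 0 < c := by positivity
  refine PhragmenLindelof.horizontal_strip (a := -η) (b := η) hF.diffContOnCl
    ⟨c, ?_, B * (1 + η ^ 2 + 2 / c ^ 2), ?_⟩ hl hu h1 h2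
  · rw [hc, sub_neg_eq_add, ← two_mul]
    gcongr
    linarith [Real.pi_gt_three]
  · refine IsBigO.of_bound 1 ?_
    rw [eventually_inf_principal]
    refine Eventually.of_forall fun w hw => ?_
    rw [one_mul, Real.norm_of_nonneg (Real.exp_pos _).le]
    refine (hgrowth w).trans (Real.exp_le_exp.2 ?_)
    have him : w.im ^ 2 ≤ η ^ 2 := sq_le_sq' hw.1.le hw.2.le
    have hn : ‖w‖ ^ 2 = w.re ^ 2 + w.im ^ 2 := by rw [Complex.sq_norm, Complex.normSq_apply]; ring
    set t := c * |w.re| with ht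
    have ht0 : 0 ≤ t := by positivity
    have hre : w.re ^ 2 = t ^ 2 / c ^ 2 := by
      rw [ht, mul_pow, sq_abs]; field_simp
    have h3 : t ^ 2 ≤ 2 * Real.exp t := by
      have := Real.quadratic_le_exp_of_nonneg ht0
      linarith
    have h4 : 1 ≤ Real.exp t := Real.one_le_exp ht0
    rw [mul_assoc]
    refine mul_le_mul_of_nonneg_left ?_ hB
    rw [hn, hre]
    have h5 : t ^ 2 / c ^ 2 ≤ 2 / c ^ 2 * Real.exp t := by
      rw [div_mul_eq_mul_div]; gcongr
    nlinarith [sq_nonneg η]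

/-- Cauchy's theorem on `[0, T] × [-η, η]` bounds the difference of the two horizontal integrals by
the vertical sides, which stay bounded. After division by `T` the means on both lines have the same
limit, and these limits are the coefficients. -/
theorem coeff_eq_of_bounded_on_strip {F : ℂ → ℂ} (hF : Differentiable ℂ F) {η M : ℝ} (hη : 0 < η)
    (hM : ∀ z : ℂ, -η ≤ z.im → z.im ≤ η → ‖F z‖ ≤ M) {p r : ℝ → ℂ}
    (hp : Summable fun s => ‖p s‖ * Real.exp (-(2 * Real.pi * s * η)))
    (hr : Summable fun s => ‖r s‖ * Real.exp (-(2 * Real.pi * s * (-η))))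
    (hFp : ∀ z : ℂ, z.im = η → F z = dirichletSeries p z)
    (hFr : ∀ z : ℂ, z.im = -η → F z = dirichletSeries r z) : p = r := by
  ext ν
  set Φ : ℂ → ℂ := fun z => F z * cexp (-(2 * Real.pi * I * ν * z)) with hΦ
  have hΦd : Differentiable ℂ Φ := hF.mul (by fun_prop)
  have h1 : Tendsto (fun T : ℝ => (T : ℂ)⁻¹ * ∫ x in (0 : ℝ)..T, Φ (x + (η : ℝ) * I)) atTop
      (nhds (p ν)) := by
    refine (tendsto_mean_dirichletSeries hp ν).congr fun T => ?_
    simp only [hΦ]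
    congr 2
    ext x
    rw [hFp _ (by simp)]
  have h2 : Tendsto (fun T : ℝ => (T : ℂ)⁻¹ * ∫ x in (0 : ℝ)..T, Φ (x + (-η : ℝ) * I)) atTop
      (nhds (r ν)) := by
    refine (tendsto_mean_dirichletSeries hr ν).congr fun T => ?_
    simp only [hΦ]
    congr 2
    ext x
    rw [hFr _ (by simp)]
  have hM0 : 0 ≤ M := (norm_nonneg _).trans (hM 0 (by simp [hη.le]) (by simp [hη.le]))
  set K := M * Real.exp (2 * Real.pi * |ν| * η) with hK
  have hK' : ∀ z : ℂ, -η ≤ z.im → z.im ≤ η → ‖Φ z‖ ≤ K := by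
    intro z hz1 hz2
    rw [hΦ, norm_mul]
    refine mul_le_mul (hM z hz1 hz2) ?_ (norm_nonneg _) hM0
    rw [Complex.norm_exp]
    have : (-(2 * Real.pi * I * ν * z)).re = 2 * Real.pi * (ν * z.im) := by simp; ring
    rw [this, mul_assoc (2 * Real.pi)]
    have hpi := Real.pi_pos
    have h3 : ν * z.im ≤ |ν| * η :=
      (le_abs_self _).trans (by rw [abs_mul]; gcongr; exact abs_le.2 ⟨hz1, hz2⟩)
    gcongr
  have h3 : Tendsto (fun T : ℝ => (T : ℂ)⁻¹ * (∫ x in (0 : ℝ)..T, Φ (x + (-η : ℝ) * I)) -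
      (T : ℂ)⁻¹ * ∫ x in (0 : ℝ)..T, Φ (x + (η : ℝ) * I)) atTop (nhds 0) := by
    rw [tendsto_zero_iff_norm_tendsto_zero]
    have hlim : Tendsto (fun T : ℝ => T⁻¹ * (2 * (K * (2 * η)))) atTop (nhds 0) := by
      simpa only [zero_mul] using (tendsto_inv_atTop_zero (𝕜 := ℝ)).mul_const _
    refine squeeze_zero' (Eventually.of_forall fun _ => norm_nonneg _) ?_ hlim
    filter_upwards [eventually_gt_atTop 0] with T hT
    have hC := Complex.integral_boundary_rect_eq_zero_of_differentiableOn Φ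
      (((-η : ℝ) : ℂ) * I) ((T : ℂ) + (η : ℝ) * I) hΦd.differentiableOn
    have hv : ∀ c : ℝ, ‖∫ y in (-η)..η, Φ (c + y * I)‖ ≤ K * (2 * η) := by
      intro c
      have := intervalIntegral.norm_integral_le_of_norm_le_const (a := -η) (b := η) (C := K)
        (f := fun y : ℝ => Φ (c + y * I)) fun y hy => by
          rw [Set.uIoc_of_le (by linarith)] at hy
          exact hK' _ (by simpa using hy.1.le) (by simpa using hy.2)
      rwa [sub_neg_eq_add, ← two_mul, abs_of_pos (by positivity)] at this
    have e1 : (((-η : ℝ) : ℂ) * I).re = 0 := by simp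
    have e2 : (((-η : ℝ) : ℂ) * I).im = -η := by simp
    have e3 : ((T : ℂ) + (η : ℝ) * I).re = T := by simp
    have e4 : ((T : ℂ) + (η : ℝ) * I).im = η := by simp
    rw [e1, e2, e3, e4] at hC
    rw [← mul_sub, norm_mul, norm_inv, Complex.norm_real, Real.norm_of_nonneg hT.le]
    refine mul_le_mul_of_nonneg_left ?_ (by positivity)
    have h5 : (∫ x in (0 : ℝ)..T, Φ (x + (-η : ℝ) * I)) -
        (∫ x in (0 : ℝ)..T, Φ (x + (η : ℝ) * I)) =
        I • (∫ y in (-η)..η, Φ ((0 : ℝ) + y * I)) - I • ∫ y in (-η)..η, Φ (T + y * I) := by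
      linear_combination hC
    rw [h5]
    refine (norm_sub_le _ _).trans ?_
    rw [norm_smul, norm_smul, Complex.norm_I, one_mul, one_mul, two_mul]
    exact add_le_add (hv 0) (hv T)
  have h4 := tendsto_nhds_unique (h2.sub h1) h3
  exact (sub_eq_zero.1 h4).symm

/-! ### Integrating the logarithmic derivative; the linear terms in both half-planes. -/

/-- `c₁` and `c₀` are the two constants of integration on the connected half-plane. All frequencies
being positive, the differentiated series dies out as `Im z → ∞`, so `c₁` can be recovered as a
limit of `F'/F`. -/
theorem exists_eq_exp_of_deriv_logDeriv {F : ℂ → ℂ} (hF : Differentiable ℂ F) {β : ℝ → ℂ}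
    (hβ : ∀ s ≤ 0, β s = 0) {η : ℝ}
    (hs : Summable fun s => ‖β s‖ * Real.exp (-(2 * Real.pi * s * η)))
    (hne : ∀ z : ℂ, η < z.im → F z ≠ 0)
    (hd : ∀ z : ℂ, η < z.im → HasDerivAt (logDeriv F)
      (-dirichletSeries (fun s => 2 * Real.pi * I * s * (2 * Real.pi * I * s * β s)) z) z) :
    ∃ c₀ c₁ : ℂ, (∀ z : ℂ, η < z.im →
      F z = c₀ * cexp (c₁ * z) * cexp (-dirichletSeries β z)) ∧
      Tendsto (fun y : ℝ => logDeriv F (y * I)) atTop (nhds c₁) := by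
  have hβ' : ∀ s < 0, β s = 0 := fun s h => hβ s h.le
  set β₁ : ℝ → ℂ := fun s => 2 * Real.pi * I * s * β s with hβ₁
  have hβ₁0 : ∀ s ≤ 0, β₁ s = 0 := fun s h => by simp [hβ₁, hβ s h]
  set U : Set ℂ := {z : ℂ | η < z.im} with hU
  have hUo : IsOpen U := Complex.isOpen_im_gt η
  have hUc : IsPreconnected U := (convex_halfSpace_im_gt η).isPreconnected
  have h1 : ∀ z ∈ U, HasDerivAt (dirichletSeries β) (dirichletSeries β₁ z) z := fun z hz =>
    hasDerivAt_dirichletSeries_of_nonneg hβ' hs hz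
  have h2 : ∀ z ∈ U, HasDerivAt (dirichletSeries β₁)
      (dirichletSeries (fun s => 2 * Real.pi * I * s * β₁ s) z) z := fun z hz => by
    obtain ⟨η', h3, h4⟩ := exists_between (show η < z.im from hz)
    exact hasDerivAt_dirichletSeries_of_nonneg (fun s h => hβ₁0 s h.le)
      (summable_deriv_coeff hβ' h3 hs) h4
  have h3 : ∀ z ∈ U, HasDerivAt (fun z => logDeriv F z + dirichletSeries β₁ z) 0 z :=
    fun z hz => ((hd z hz).add (h2 z hz)).congr_deriv (neg_add_cancel _)
  obtain ⟨c₁, hc₁⟩ := hUo.exists_is_const_of_deriv_eq_zero hUc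
    (fun z hz => (h3 z hz).differentiableAt.differentiableWithinAt) (fun z hz => (h3 z hz).deriv)
  have h4 : ∀ z ∈ U, HasDerivAt
      (fun z => F z * cexp (dirichletSeries β z) * cexp (-(c₁ * z))) 0 z := by
    intro z hz
    have e1 : HasDerivAt (fun z => -(c₁ * z)) (-(c₁ * 1)) z :=
      ((hasDerivAt_id z).const_mul c₁).neg
    refine (((hF z).hasDerivAt.mul (h1 z hz).cexp).mul e1.cexp).congr_deriv ?_
    have e2 : deriv F z = (c₁ - dirichletSeries β₁ z) * F z := by
      have := hc₁ z hz
      rw [logDeriv_apply] at this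
      rw [← this, add_sub_cancel_right, div_mul_cancel₀ _ (hne z hz)]
    simp only [e2, Pi.mul_apply]
    ring
  obtain ⟨c₀, hc₀⟩ := hUo.exists_is_const_of_deriv_eq_zero hUc
    (fun z hz => (h4 z hz).differentiableAt.differentiableWithinAt) (fun z hz => (h4 z hz).deriv)
  refine ⟨c₀, c₁, fun z hz => ?_, ?_⟩
  · rw [← hc₀ z hz]
    have e1 : cexp (-(c₁ * z)) * cexp (c₁ * z) = 1 := by
      rw [← Complex.exp_add, neg_add_cancel, Complex.exp_zero]
    have e2 : cexp (dirichletSeries β z) * cexp (-dirichletSeries β z) = 1 := by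
      rw [← Complex.exp_add, add_neg_cancel, Complex.exp_zero]
    linear_combination (-F z * cexp (dirichletSeries β z) * cexp (-dirichletSeries β z)) * e1 -
      F z * e2
  · have h5 := (tendsto_dirichletSeries_atTop hβ₁0
      (summable_deriv_coeff hβ' (lt_add_one η) hs)).const_sub c₁
    rw [sub_zero] at h5
    refine h5.congr' ?_
    filter_upwards [eventually_gt_atTop η] with y hy
    rw [← hc₁ (y * I) (by simpa [hU] using hy), add_sub_cancel_right]

/-- The real parts of the two terms almost cancel: their difference carries the factor `4xyv`, with
`|v| ≤ H` and `|x|y ≤ x² + y²/4`. This gains the extra decay that makes the sum over the points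
converge to zero. -/
theorem re_inv_sub_inv_bound {H y : ℝ} {c : ℂ} (hc : |c.im| ≤ H) (hy : 4 * H + 2 ≤ y) :
    ‖((y * I - c)⁻¹ - (-(y * I) - c)⁻¹).re‖ ≤ 4 * H / (c.re ^ 2 + y ^ 2 / 4) := by
  have hH : 0 ≤ H := (abs_nonneg _).trans hc
  obtain ⟨hv1, hv2⟩ := abs_le.1 hc
  have hy0 : 0 < y := by linarith
  set x := c.re
  set v := c.im
  set E := x ^ 2 + y ^ 2 / 4 with hE
  have hEpos : 0 < E := by positivity
  have hD1 : E ≤ x ^ 2 + (y - v) ^ 2 := by rw [hE]; nlinarith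
  have hD2 : E ≤ x ^ 2 + (y + v) ^ 2 := by rw [hE]; nlinarith
  have h1 : ((y * I - c)⁻¹ - (-(y * I) - c)⁻¹).re =
      -(4 * x * y * v) / ((x ^ 2 + (y - v) ^ 2) * (x ^ 2 + (y + v) ^ 2)) := by
    rw [Complex.sub_re, Complex.inv_re, Complex.inv_re, Complex.normSq_apply, Complex.normSq_apply]
    simp only [Complex.sub_re, Complex.sub_im, Complex.mul_re, Complex.mul_im, Complex.ofReal_re,
      Complex.ofReal_im, Complex.I_re, Complex.I_im, Complex.neg_re, Complex.neg_im]
    have e1 : (y * 0 - 0 * 1 - c.re) * (y * 0 - 0 * 1 - c.re) +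
        (y * 1 + 0 * 0 - c.im) * (y * 1 + 0 * 0 - c.im) = x ^ 2 + (y - v) ^ 2 := by ring
    have e2 : (-(y * 0 - 0 * 1) - c.re) * (-(y * 0 - 0 * 1) - c.re) +
        (-(y * 1 + 0 * 0) - c.im) * (-(y * 1 + 0 * 0) - c.im) = x ^ 2 + (y + v) ^ 2 := by ring
    rw [e1, e2, div_sub_div _ _ (hEpos.trans_le hD1).ne' (hEpos.trans_le hD2).ne']
    congr 1
    ring
  have hxy : |x| * y ≤ E := by
    rw [hE, ← sq_abs x]
    nlinarith [sq_nonneg (|x| - y / 2)]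
  rw [h1, norm_div, Real.norm_eq_abs, Real.norm_eq_abs, abs_neg, abs_mul, abs_mul, abs_mul,
    abs_of_pos (mul_pos (hEpos.trans_le hD1) (hEpos.trans_le hD2)), abs_of_pos hy0,
    abs_of_pos (show (0 : ℝ) < 4 by norm_num)]
  calc 4 * |x| * y * |v| / ((x ^ 2 + (y - v) ^ 2) * (x ^ 2 + (y + v) ^ 2))
      ≤ 4 * |x| * y * |v| / (E * E) := by gcongr
    _ = 4 * (|x| * y) * |v| / (E * E) := by ring
    _ ≤ 4 * E * H / (E * E) := by gcongr
    _ = 4 * H / E := by field_simp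

theorem tendsto_re_logDeriv_canonicalProduct_sub {ι : Type*} {a : ι → ℂ} {H : ℝ} (hH : 0 ≤ H)
    (ha : ∀ i, |(a i).im| ≤ H) (hp : ∀ i, a i ≠ (H + 1 : ℝ) * I)
    (hs : Summable fun i => (‖a i - (H + 1 : ℝ) * I‖ ^ 2)⁻¹) :
    Tendsto (fun y : ℝ => (logDeriv (canonicalProduct a ((H + 1 : ℝ) * I)) (y * I) -
      logDeriv (canonicalProduct a ((H + 1 : ℝ) * I)) (-(y * I))).re) atTop (nhds 0) := by
  have hdist : ∀ y : ℝ, 4 * H + 2 ≤ y → ∀ i, 1 ≤ ‖y * I - a i‖ ∧ 1 ≤ ‖-(y * I) - a i‖ := by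
    intro y hy i
    have h1 := abs_le.1 (ha i)
    constructor
    · refine le_trans ?_ (Complex.abs_im_le_norm _)
      simp only [Complex.sub_im, Complex.mul_im, Complex.ofReal_re, Complex.I_im, mul_one,
        Complex.ofReal_im, Complex.I_re, mul_zero, add_zero]
      exact le_trans (by linarith) (le_abs_self _)
    · refine le_trans ?_ (Complex.abs_im_le_norm _)
      simp only [Complex.sub_im, Complex.neg_im, Complex.mul_im, Complex.ofReal_re, Complex.I_im,
        mul_one, Complex.ofReal_im, Complex.I_re, mul_zero, add_zero]
      exact le_trans (by linarith) (neg_le_abs _)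
  have heq : ∀ y : ℝ, 4 * H + 2 ≤ y →
      (logDeriv (canonicalProduct a ((H + 1 : ℝ) * I)) (y * I) -
        logDeriv (canonicalProduct a ((H + 1 : ℝ) * I)) (-(y * I))).re =
      ∑' i, ((y * I - a i)⁻¹ - (-(y * I) - a i)⁻¹).re := by
    intro y hy
    have s1 := summable_logDeriv_elementaryFactor hs hp one_pos fun i => (hdist y hy i).1
    have s2 := summable_logDeriv_elementaryFactor hs hp one_pos fun i => (hdist y hy i).2
    rw [logDeriv_canonicalProduct hs hp one_pos fun i => (hdist y hy i).1,
      logDeriv_canonicalProduct hs hp one_pos fun i => (hdist y hy i).2, ← s1.tsum_sub s2,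
      Complex.re_tsum (s1.sub s2)]
    -- The convergence terms `(a i - p)⁻¹` cancel in the difference.
    simp only [add_sub_add_right_eq_sub]
  have h0 : (0 : ℝ) = ∑' _ : ι, (0 : ℝ) := tsum_zero.symm
  have hlim : Tendsto (fun y : ℝ => ∑' i, ((y * I - a i)⁻¹ - (-(y * I) - a i)⁻¹).re) atTop
      (nhds 0) := by
    rw [h0]
    refine tendsto_tsum_of_dominated_convergence (hs.mul_left (4 * H)) (fun i => ?_) ?_
    · rw [tendsto_zero_iff_norm_tendsto_zero]
      have e1 : Tendsto (fun y : ℝ => 16 * H * (y ^ 2)⁻¹) atTop (nhds 0) := by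
        have := ((tendsto_pow_atTop (α := ℝ) two_ne_zero).inv_tendsto_atTop).const_mul (16 * H)
        rw [mul_zero] at this
        exact this
      refine squeeze_zero' (Eventually.of_forall fun _ => norm_nonneg _) ?_ e1
      filter_upwards [eventually_ge_atTop (4 * H + 2)] with y hy
      have hy0 : 0 < y := by linarith
      refine (re_inv_sub_inv_bound (ha i) hy).trans ?_
      calc 4 * H / ((a i).re ^ 2 + y ^ 2 / 4) ≤ 4 * H / (y ^ 2 / 4) := by
            gcongr
            nlinarith [sq_nonneg (a i).re]
        _ = _ := by field_simp; ring
    · filter_upwards [eventually_ge_atTop (4 * H + 2)] with y hy i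
      refine (re_inv_sub_inv_bound (ha i) hy).trans ?_
      rw [div_eq_mul_inv]
      have h1 := abs_le.1 (ha i)
      have h4 : ‖a i - (H + 1 : ℝ) * I‖ ^ 2 = (a i).re ^ 2 + ((a i).im - (H + 1)) ^ 2 := by
        rw [Complex.sq_norm, Complex.normSq_apply]
        simp
        ring
      have h5 : 0 < ‖a i - (H + 1 : ℝ) * I‖ ^ 2 :=
        pow_pos (norm_pos_iff.2 (sub_ne_zero.2 (hp i))) 2
      gcongr
      rw [h4]
      -- Here `2H + 1 ≤ y / 2`, which is the reason for the threshold `4H + 2`.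
      have h6 : ((a i).im - (H + 1)) ^ 2 ≤ (2 * H + 1) ^ 2 := 
        sq_le_sq' (by linarith) (by linarith)
      nlinarith
  refine hlim.congr' ?_
  filter_upwards [eventually_ge_atTop (4 * H + 2)] with y hy
  exact (heq y hy).symm

/-! ### Local finiteness of a semigroup of positive reals. -/

/-- The generators are bounded below by some `δ' > 0`. A nonzero element below `(n + 1)δ'` is a
generator in a bounded range plus an element below `nδ'`, so finiteness follows by induction on `n`.
-/
theorem finite_closure_inter_Iic {G : Set ℝ} (hpos : ∀ γ ∈ G, 0 < γ)
    (hfin : ∀ R, (Set.Icc 0 R ∩ G).Finite) (R : ℝ) :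
    ((AddSubmonoid.closure G : Set ℝ) ∩ Set.Iic R).Finite := by
  have hnn : ∀ x ∈ AddSubmonoid.closure G, 0 ≤ x := fun x hx =>
    AddSubmonoid.closure_induction (motive := fun x _ => 0 ≤ x) (fun x hx => (hpos x hx).le) le_rfl
      (fun x y _ _ hx hy => add_nonneg hx hy) hx
  obtain ⟨δ, hδ, hball⟩ := Metric.isOpen_iff.1 (hfin 1).isClosed.isOpen_compl 0
    (fun h => (hpos 0 h.2).false)
  have hδG : ∀ γ ∈ G, min δ 1 ≤ γ := by
    intro γ hγ
    by_contra hc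
    have h1 : γ < min δ 1 := not_le.1 hc
    have h2 := hpos γ hγ
    have h3 : γ ∈ Metric.ball (0 : ℝ) δ := by
      rw [Metric.mem_ball, dist_zero_right, Real.norm_of_nonneg h2.le]
      exact h1.trans_le (min_le_left _ _)
    exact hball h3 ⟨⟨h2.le, (h1.trans_le (min_le_right _ _)).le⟩, hγ⟩
  have hδ1 : 0 < min δ 1 := lt_min hδ one_pos
  have key : ∀ n : ℕ, ((AddSubmonoid.closure G : Set ℝ) ∩ Set.Iio (n * min δ 1)).Finite := by
    intro n
    induction n with
    | zero =>
      refine Set.finite_empty.subset fun x hx => ?_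
      have h1 := hnn x hx.1
      have h2 : x < (0 : ℕ) * min δ 1 := hx.2
      simp only [Nat.cast_zero, zero_mul] at h2
      exact (h1.not_gt h2).elim
    | succ n ih =>
      refine ((Set.finite_singleton (0 : ℝ)).union (Set.Finite.image2 (· + ·)
        (hfin ((n + 1) * min δ 1)) ih)).subset fun x hx => ?_
      have hxlt : x < ((n + 1 : ℕ) : ℝ) * min δ 1 := hx.2
      push_cast at hxlt
      have hmem : x = 0 ∨ ∃ g ∈ G, ∃ y ∈ AddSubmonoid.closure G, g + y = x := by
        refine AddSubmonoid.closure_induction_left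
          (motive := fun x _ => x = 0 ∨ ∃ g ∈ G, ∃ y ∈ AddSubmonoid.closure G, g + y = x)
          (Or.inl rfl) (fun g hg y hy _ => Or.inr ⟨g, hg, y, hy, rfl⟩) hx.1
      rcases hmem with rfl | ⟨g, hg, y, hy, rfl⟩
      · exact Or.inl rfl
      · refine Or.inr ⟨g, ⟨⟨(hpos g hg).le, ?_⟩, hg⟩, y, ⟨hy, ?_⟩, rfl⟩
        · linarith [hnn y hy]
        · have := hδG g hg
          change y < n * min δ 1
          linarith
  obtain ⟨n, hn⟩ := exists_nat_gt (R / min δ 1)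
  refine (key n).subset fun x hx => ⟨hx.1, ?_⟩
  have h1 : R < n * min δ 1 := (div_lt_iff₀ hδ1).1 hn
  exact lt_of_le_of_lt hx.2 h1

/-! ### Dirichlet expansions of the canonical product in both half-planes. -/

/-- Passing to `z ↦ f (σz)` brings the lower half-plane to the upper one. Dividing the coefficient
`s · b(σs)` of `tsum_inv_sq_eq` by `s²`, for the two integrations, leaves `b(σs)/s`. -/
theorem canonicalProduct_eq_exp {H : ℝ} {A : ℂ → ℕ} (hA : IsStripMultiset H A) {p : ℂ}
    (hs : Summable fun i : Σ z : ℂ, Fin (A z) => (‖i.1 - p‖ ^ 2)⁻¹)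
    (hp : ∀ i : Σ z : ℂ, Fin (A z), i.1 ≠ p)
    {b : ℝ → ℂ} (hb : CFourierIsPurePoint (countingMeasure A) b) {η : ℝ} (hη : H ≤ η)
    (hbs : Summable fun γ : ℝ => ‖b γ‖ * Real.exp (-(2 * Real.pi * η * |γ|)))
    (hbd : Summable fun γ : ℝ => ‖b γ / (γ : ℂ)‖ * Real.exp (-(2 * Real.pi * η * |γ|)))
    {σ : ℝ} (hσ : σ = 1 ∨ σ = -1) {β : ℝ → ℂ}
    (hβ : β = fun s => if 0 < s then b (σ * s) / (s : ℂ) else 0) :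
    (Summable fun s => ‖β s‖ * Real.exp (-(2 * Real.pi * s * η))) ∧
    ∃ c₀ c₁ : ℂ, (∀ z : ℂ, η < z.im →
      canonicalProduct (fun i : Σ z : ℂ, Fin (A z) => i.1) p (σ * z) =
        c₀ * cexp (c₁ * z) * cexp (-dirichletSeries β z)) ∧
      Tendsto (fun y : ℝ => logDeriv (canonicalProduct (fun i : Σ z : ℂ, Fin (A z) => i.1) p)
        (σ * (y * I)) * σ) atTop (nhds c₁) := by
  set f := canonicalProduct (fun i : Σ z : ℂ, Fin (A z) => i.1) p with hf
  have hfd : Differentiable ℂ f := differentiable_canonicalProduct hs hp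
  have hσ2 : σ * σ = 1 := by rcases hσ with rfl | rfl <;> norm_num
  have hσ2' : (σ : ℂ) * σ = 1 := by exact_mod_cast hσ2
  have hσ0 : σ ≠ 0 := by rintro rfl; simp at hσ2
  have hσa : |σ| = 1 := by rcases hσ with rfl | rfl <;> norm_num
  have hmul : ∀ s, (Equiv.mulLeft₀ σ hσ0) s = σ * s := fun _ => rfl
  have hβ0 : ∀ s ≤ 0, β s = 0 := fun s h => by simp [hβ, h.not_gt]
  have hβs : Summable fun s => ‖β s‖ * Real.exp (-(2 * Real.pi * s * η)) := by
    refine Summable.of_nonneg_of_le (fun s => by positivity) (fun s => ?_)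
      ((Equiv.mulLeft₀ σ hσ0).summable_iff.2 hbd)
    rcases le_or_gt s 0 with h | h
    · rw [hβ0 s h, norm_zero, zero_mul]
      simp only [Function.comp]
      positivity
    · have h1 : |σ * s| = s := by rw [abs_mul, hσa, one_mul, abs_of_pos h]
      have h2 : ‖((σ * s : ℝ) : ℂ)‖ = ‖(s : ℂ)‖ := by
        rw [Complex.norm_real, Complex.norm_real, Real.norm_eq_abs, h1, Real.norm_of_nonneg h.le]
      simp only [Function.comp, hmul, hβ, if_pos h]
      rw [norm_div, norm_div, h2, h1]
      refine le_of_eq ?_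
      congr 3
      ring
  refine ⟨hβs, ?_⟩
  have hlog : logDeriv (fun z : ℂ => f (σ * z)) = fun z => logDeriv f (σ * z) * σ := by
    ext z
    have h1 : HasDerivAt (fun z : ℂ => (σ : ℂ) * z) (σ * 1) z := (hasDerivAt_id z).const_mul _
    have h2 := logDeriv_comp (f := f) (g := fun z : ℂ => (σ : ℂ) * z) (x := z) (hfd _)
      h1.differentiableAt
    rw [h1.deriv, mul_one] at h2
    exact h2
  have hdist : ∀ z : ℂ, η < z.im → ∀ i : Σ z : ℂ, Fin (A z), z.im - H ≤ ‖σ * z - i.1‖ := by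
    intro z hz i
    have h1 := hA.abs_im_le i.1 fun h => by have := i.2.2; omega
    have h2 : σ * (σ * z - i.1).im = z.im - σ * i.1.im := by
      simp only [Complex.sub_im, Complex.mul_im, Complex.ofReal_re, Complex.ofReal_im, zero_mul,
        add_zero]
      linear_combination z.im * hσ2
    have h3 : σ * i.1.im ≤ H := (le_abs_self _).trans (by rw [abs_mul, hσa, one_mul]; exact h1)
    calc z.im - H ≤ σ * (σ * z - i.1).im := by rw [h2]; linarith
      _ ≤ |σ * (σ * z - i.1).im| := le_abs_self _
      _ = |(σ * z - i.1).im| := by rw [abs_mul, hσa, one_mul]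
      _ ≤ _ := Complex.abs_im_le_norm _
  have hres := exists_eq_exp_of_deriv_logDeriv (F := fun z : ℂ => f (σ * z))
    (hfd.comp (by fun_prop)) hβ0 hβs (fun z hz => ?_) fun z hz => ?_
  · rwa [hlog] at hres
  · refine canonicalProduct_ne_zero hs hp fun i hi => ?_
    have := hdist z hz i
    rw [← hi, sub_self, norm_zero] at this
    linarith
  · have hd0 : 0 < z.im - H := by linarith
    have h1 := hasDerivAt_logDeriv_canonicalProduct hs hp hd0 (hdist z hz)
    have h2 : HasDerivAt (fun z : ℂ => (σ : ℂ) * z) (σ * 1) z := (hasDerivAt_id z).const_mul _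
    have h3 := (HasDerivAt.comp (h₂ := logDeriv f) z h1 h2).mul_const (σ : ℂ)
    rw [hlog]
    refine h3.congr_deriv ?_
    have him : σ * (σ * z : ℂ).im = z.im := by
      simp only [Complex.mul_im, Complex.ofReal_re, Complex.ofReal_im, zero_mul, add_zero]
      linear_combination z.im * hσ2
    have hK := tsum_inv_sq_eq hA hs hp hb hbs hσ (z := σ * z) (by rw [him]; linarith)
      (by rw [him]; exact hz)
    rw [hK, ← (Equiv.mulLeft₀ σ hσ0).tsum_eq, dirichletSeries, ← tsum_neg, mul_one, mul_assoc, hσ2',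
      mul_one, ← tsum_mul_left, ← tsum_neg]
    refine tsum_congr fun s => ?_
    simp only [hmul, hβ]
    have e1 : σ * (σ * s) = s := by rw [← mul_assoc, hσ2, one_mul]
    have e2 : 2 * Real.pi * I * ((σ * s : ℝ) : ℂ) * (σ * z) = 2 * Real.pi * I * s * z := by
      push_cast
      linear_combination (2 * Real.pi * I * s * z) * hσ2'
    rw [e1, e2]
    rcases le_or_gt s 0 with h | h
    · rw [max_eq_right h, if_neg h.not_gt]; simp
    · rw [max_eq_left h.le, if_pos h]
      have hsne : (s : ℂ) ≠ 0 := Complex.ofReal_ne_zero.2 h.ne'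
      have hI := Complex.I_sq
      field_simp
      linear_combination (4 * b (σ * s)) * hI

/-- The coefficients are those of the convolution exponential of `-β`, translated by `ν`; the
support statement later yields both the one-sided bound on the spectrum and its finiteness. -/
theorem exists_dirichletSeries_eq {F : ℂ → ℂ} {β : ℝ → ℂ} (hβ : ∀ s ≤ 0, β s = 0) {η η' : ℝ}
    (hη : η < η') (hs : Summable fun s => ‖β s‖ * Real.exp (-(2 * Real.pi * s * η))) {c : ℂ} {ν : ℝ}
    (hF : ∀ z : ℂ, η < z.im →
      F z = c * cexp (2 * Real.pi * I * ν * z) * cexp (-dirichletSeries β z)) :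
    ∃ p : ℝ → ℂ, (Summable fun s => ‖p s‖ * Real.exp (-(2 * Real.pi * s * η'))) ∧
      (∀ z : ℂ, η' ≤ z.im → F z = dirichletSeries p z) ∧
      ∀ s, p s ≠ 0 → s - ν ∈ AddSubmonoid.closure (Function.support β) := by
  have hpi := Real.pi_pos
  set q : ℝ → ℂ := fun s => -β s with hq
  have hsupp : ∀ s ∉ AddSubmonoid.closure (Function.support β), q s = 0 := fun s h => by
    have : β s = 0 := by
      by_contra h0
      exact h (AddSubmonoid.subset_closure h0)
    rw [hq]; simp [this]
  have hnn : ∀ s ∈ AddSubmonoid.closure (Function.support β), 0 ≤ s := fun s h =>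
    AddSubmonoid.closure_induction (motive := fun x _ => 0 ≤ x)
      (fun x hx => by by_contra h0; exact hx (hβ x (not_le.1 h0).le)) le_rfl
      (fun x y _ _ hx hy => add_nonneg hx hy) h
  have hqs : Summable fun s => ‖q s‖ * Real.exp (-(2 * Real.pi * s * η')) := by
    refine Summable.of_nonneg_of_le (fun s => by positivity) (fun s => ?_) hs
    rcases le_or_gt s 0 with h | h
    · simp [hq, hβ s h]
    · rw [hq, norm_neg]
      gcongr
  have hqDS : ∀ z, dirichletSeries q z = -dirichletSeries β z := fun z => by
    rw [dirichletSeries, dirichletSeries, ← tsum_neg]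
    exact tsum_congr fun s => by rw [hq, neg_mul]
  refine ⟨fun s => c * convolutionExp q (s - ν), ?_, fun z hz => ?_, fun s hsne => ?_⟩
  · have h1 := (summable_convolutionExp_mul_exp hqs).mul_left
      (‖c‖ * Real.exp (-(2 * Real.pi * ν * η')))
    refine ((Equiv.subRight ν).summable_iff.2 h1).congr fun s => ?_
    have h2 : Real.exp (-(2 * Real.pi * s * η')) = Real.exp (-(2 * Real.pi * ν * η')) *
        Real.exp (-(2 * Real.pi * (s - ν) * η')) := by
      rw [← Real.exp_add]; congr 1; ring
    simp only [Function.comp, Equiv.subRight_apply, norm_mul, h2]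
    ring
  · rw [hF z (hη.trans_le hz), ← hqDS, ← dirichletSeries_convolutionExp hsupp hnn hqs hz,
      dirichletSeries, dirichletSeries, ← tsum_mul_left, ← (Equiv.subRight ν).tsum_eq]
    refine tsum_congr fun s => ?_
    have h2 : cexp (2 * Real.pi * I * s * z) = cexp (2 * Real.pi * I * ν * z) *
        cexp (2 * Real.pi * I * ((s - ν : ℝ) : ℂ) * z) := by
      rw [← Complex.exp_add]; congr 1; push_cast; ring
    rw [Equiv.subRight_apply, h2]
    ring
  · by_contra h
    exact hsne (by simp only [convolutionExp_eq_zero hsupp _ h, mul_zero])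

theorem norm_dirichletSeries_le {p : ℝ → ℂ} {η : ℝ}
    (hp : Summable fun s => ‖p s‖ * Real.exp (-(2 * Real.pi * s * η))) {z : ℂ} (hz : z.im = η) :
    ‖dirichletSeries p z‖ ≤ ∑' s, ‖p s‖ * Real.exp (-(2 * Real.pi * s * η)) := by
  refine tsum_of_norm_bounded hp.hasSum fun s => ?_
  rw [norm_mul, norm_cexp_two_pi_I, hz]

/-- With frequencies bounded by `R` each term is at most `‖q s‖ e^{2πRB}` on `|Im z| < B`, so
convergence is uniform on every horizontal strip. -/
theorem differentiable_dirichletSeries_of_bounded {q : ℝ → ℂ} (hq : Summable fun s => ‖q s‖) {R : ℝ}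
    (hR : ∀ s, q s ≠ 0 → |s| ≤ R) : Differentiable ℂ (dirichletSeries q) := by
  have hpi := Real.pi_pos
  intro z
  set B := |z.im| + 1 with hB
  have hU : IsOpen {w : ℂ | |w.im| < B} := isOpen_lt (by fun_prop) continuous_const
  have hz : z ∈ {w : ℂ | |w.im| < B} := by
    change |z.im| < B
    linarith
  refine (differentiableOn_dirichletSeries (hq.mul_right (Real.exp (2 * Real.pi * (R * B)))) hU
    fun s w hw => ?_).differentiableAt (hU.mem_nhds hz)
  rw [norm_mul, norm_cexp_two_pi_I]
  rcases eq_or_ne (q s) 0 with h | h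
  · simp [h]
  · have h1 : -(s * w.im) ≤ R * B := by
      refine (neg_le_abs _).trans ?_
      rw [abs_mul]
      exact mul_le_mul (hR s h) (le_of_lt hw) (abs_nonneg _) ((abs_nonneg _).trans (hR s h))
    gcongr
    nlinarith

theorem analyticOrderAt_canonicalProduct_index {A : ℂ → ℕ} {p : ℂ}
    (hs : Summable fun i : Σ z : ℂ, Fin (A z) => (‖i.1 - p‖ ^ 2)⁻¹)
    (hp : ∀ i : Σ z : ℂ, Fin (A z), i.1 ≠ p) (w : ℂ) :
    analyticOrderAt (canonicalProduct (fun i : Σ z : ℂ, Fin (A z) => i.1) p) w = A w := by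
  have h := analyticOrderAt_canonicalProduct hs hp (w := w)
    (s := Finset.univ.map (Function.Embedding.sigmaMk (β := fun z => Fin (A z)) w)) (fun i => by
      simp only [Finset.mem_map, Finset.mem_univ, true_and, Function.Embedding.sigmaMk_apply]
      constructor
      · rintro ⟨k, rfl⟩; rfl
      · rintro rfl; exact ⟨i.2, rfl⟩)
  rw [h, Finset.card_map, Finset.card_univ, Fintype.card_fin]

theorem hasZeroSet_mul_exp {A : ℂ → ℕ} {p : ℂ}
    (hs : Summable fun i : Σ z : ℂ, Fin (A z) => (‖i.1 - p‖ ^ 2)⁻¹)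
    (hp : ∀ i : Σ z : ℂ, Fin (A z), i.1 ≠ p) (c : ℂ) :
    HasZeroSet (fun z => canonicalProduct (fun i : Σ z : ℂ, Fin (A z) => i.1) p z *
      cexp (c * z)) A := by
  intro w
  have h1 := (differentiable_canonicalProduct hs hp).analyticAt w
  have h2 : AnalyticAt ℂ (fun z => cexp (c * z)) w :=
    (by fun_prop : Differentiable ℂ fun z => cexp (c * z)).analyticAt w
  refine ⟨h1.mul h2, ?_⟩
  have h3 := analyticOrderAt_mul h1 h2
  rw [h2.analyticOrderAt_eq_zero.2 (Complex.exp_ne_zero _), add_zero,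
    analyticOrderAt_canonicalProduct_index hs hp] at h3
  exact h3

theorem exists_norm_canonicalProduct_mul_exp_le {ι : Type*} {a : ι → ℂ} {p : ℂ}
    (hs : Summable fun i => (‖a i - p‖ ^ 2)⁻¹) (hp : ∀ i, a i ≠ p) (c : ℂ) :
    ∃ B, 0 ≤ B ∧ ∀ z,
      ‖canonicalProduct a p z * cexp (c * z)‖ ≤ Real.exp (B * (1 + ‖z‖ ^ 2)) := by
  set T := ∑' i, (‖a i - p‖ ^ 2)⁻¹ with hT
  have hT0 : 0 ≤ T := tsum_nonneg fun i => by positivity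
  refine ⟨6 * (1 + ‖p‖ ^ 2) * T + ‖c‖, by positivity, fun z => ?_⟩
  rw [norm_mul, Complex.norm_exp]
  refine (mul_le_mul_of_nonneg_right (norm_canonicalProduct_le hs hp z) (Real.exp_pos _).le).trans ?_
  rw [← Real.exp_add]
  refine Real.exp_le_exp.2 ?_
  have h1 : (c * z).re ≤ ‖c‖ * ‖z‖ := (Complex.re_le_norm _).trans (norm_mul c z).le
  have h2 : ‖z - p‖ ^ 2 ≤ 2 * ((1 + ‖p‖ ^ 2) * (1 + ‖z‖ ^ 2)) := by
    have := norm_sub_le z p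
    have h3 : ‖z - p‖ ^ 2 ≤ (‖z‖ + ‖p‖) ^ 2 := by gcongr
    nlinarith [sq_nonneg (‖z‖ - ‖p‖), sq_nonneg (‖z‖ * ‖p‖)]
  have h4 : ‖z‖ ≤ 1 + ‖z‖ ^ 2 := by nlinarith [sq_nonneg (‖z‖ - 1)]
  calc 3 * ‖z - p‖ ^ 2 * T + (c * z).re
      ≤ 3 * (2 * ((1 + ‖p‖ ^ 2) * (1 + ‖z‖ ^ 2))) * T + ‖c‖ * (1 + ‖z‖ ^ 2) := by
        refine add_le_add (by gcongr) (h1.trans (by gcongr))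
    _ = _ := by ring

end

/-! ### Gluing the two expansions. -/

theorem theorem2 (H : ℝ) (A : ℂ → ℕ) (hA : IsStripMultiset H A)
    (hap : AlmostPeriodicMeasure (countingMeasure A))
    (b : ℝ → ℂ) (hb : CFourierIsPurePoint (countingMeasure A) b)
    (hvar : (fun r : ℝ => Real.log (∑' γ : {γ : ℝ // |γ| < r}, ‖b γ‖)) =O[atTop] fun r : ℝ => r)
    (hneig : Summable fun γ : {γ : ℝ // 0 < |γ| ∧ |γ| < 1} => ‖b γ / ((γ : ℝ) : ℂ)‖) :
    ∃ q : ℝ → ℂ, (Summable fun s : ℝ => ‖q s‖) ∧ Bornology.IsBounded (Function.support q) ∧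
      HasZeroSet (dirichletSeries q) A ∧
      (LocFiniteSet (Function.support b) → (Function.support q).Finite) := by
  wlog hH : 0 ≤ H generalizing H
  -- For negative `H` the strip may be enlarged to the real line.
  · exact this 0 ⟨fun z hz => (hA.abs_im_le z hz).trans (not_le.1 hH).le, hA.locFinite⟩ le_rfl
  have hpi := Real.pi_pos
  set p : ℂ := (H + 1 : ℝ) * I with hpdef
  have hs : Summable fun i : Σ z : ℂ, Fin (A z) => (‖i.1 - p‖ ^ 2)⁻¹ :=
    summable_inv_sq_of_almostPeriodic hA hap
  have him : ∀ i : Σ z : ℂ, Fin (A z), |i.1.im| ≤ H := fun i =>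
    hA.abs_im_le i.1 fun h => by have := i.2.2; omega
  have hp : ∀ i : Σ z : ℂ, Fin (A z), i.1 ≠ p := fun i h => by
    have h1 := (le_abs_self _).trans (him i)
    have h2 : p.im = H + 1 := by simp [hpdef]
    rw [h, h2] at h1
    linarith
  obtain ⟨η₀, hη₀, hbs₀⟩ := exists_summable_norm_mul_exp hb.locSummable hvar
  set η := max η₀ H with hη
  have hη0 : 0 < η := hη₀.trans_le (le_max_left _ _)
  have hbs : Summable fun γ : ℝ => ‖b γ‖ * Real.exp (-(2 * Real.pi * η * |γ|)) := by
    refine Summable.of_nonneg_of_le (fun γ => by positivity) (fun γ => ?_) hbs₀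
    gcongr
    exact le_max_left _ _
  have hbd := summable_norm_div_mul_exp (by positivity) hbs hneig
  set β : ℝ → ℝ → ℂ := fun σ s => if 0 < s then b (σ * s) / (s : ℂ) else 0 with hβ
  have hβ0 : ∀ σ, ∀ s ≤ 0, β σ s = 0 := fun σ s h => by simp [hβ, h.not_gt]
  obtain ⟨hs1, c₀, c₁, hc, hclim⟩ := canonicalProduct_eq_exp hA hs hp hb (le_max_right _ _) hbs hbd
    (σ := 1) (Or.inl rfl) (β := β 1) rfl
  obtain ⟨hs2, d₀, d₁, hd, hdlim⟩ := canonicalProduct_eq_exp hA hs hp hb (le_max_right _ _) hbs hbd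
    (σ := -1) (Or.inr rfl) (β := β (-1)) rfl
  -- The factor `σ = -1` in the second limit makes `c₁ + d₁` the limit of `(f'/f)(iy) -
  -- (f'/f)(-iy)`.
  have hre : (c₁ + d₁).re = 0 := by
    have h1 := (Complex.continuous_re.tendsto _).comp (hclim.add hdlim)
    refine tendsto_nhds_unique h1 ?_
    refine (tendsto_re_logDeriv_canonicalProduct_sub hH him hp hs).congr fun y => ?_
    simp [sub_eq_add_neg, hpdef]
  set ν : ℝ := (c₁ + d₁).im / (4 * Real.pi) with hν
  have hcd : 2 * Real.pi * I * ν = (c₁ + d₁) / 2 := by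
    have h1 : c₁ + d₁ = (c₁ + d₁).im * I := by
      apply Complex.ext
      · simpa using hre
      · simp
    have h2 : (Real.pi : ℂ) ≠ 0 := Complex.ofReal_ne_zero.2 hpi.ne'
    rw [hν]
    push_cast
    rw [h1]
    simp only [Complex.mul_im, Complex.ofReal_re, Complex.I_im, mul_one, Complex.ofReal_im,
      Complex.I_re, mul_zero, add_zero]
    field_simp
    ring
  -- This choice replaces both `c₁` and `d₁` by their average `2πiν`, whose frequency `ν` is real
  -- because `c₁ + d₁` is purely imaginary.
  set l := -((c₁ - d₁) / 2) with hl
  set F : ℂ → ℂ := fun z =>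
    canonicalProduct (fun i : Σ z : ℂ, Fin (A z) => i.1) p z * cexp (l * z) with hF
  have hFd : Differentiable ℂ F := (differentiable_canonicalProduct hs hp).mul (by fun_prop)
  obtain ⟨q, hq, hFq, hqS⟩ := exists_dirichletSeries_eq (F := F) (hβ0 1) (lt_add_one η) hs1
    (c := c₀) (ν := ν) fun z hz => by
      have h1 := hc z hz
      rw [Complex.ofReal_one, one_mul] at h1
      rw [hF]
      simp only
      rw [h1, hcd]
      have h2 : cexp ((c₁ + d₁) / 2 * z) = cexp (c₁ * z) * cexp (l * z) := by
        rw [← Complex.exp_add, hl]; congr 1; ring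
      rw [h2]
      ring
  obtain ⟨r, hr, hFr, hrS⟩ := exists_dirichletSeries_eq (F := fun z => F (-z)) (hβ0 (-1))
    (lt_add_one η) hs2 (c := d₀) (ν := ν) fun z hz => by
      have h1 := hd z hz
      rw [Complex.ofReal_neg, Complex.ofReal_one, neg_one_mul] at h1
      rw [hF]
      simp only
      rw [h1, hcd]
      have h2 : cexp ((c₁ + d₁) / 2 * z) = cexp (d₁ * z) * cexp (l * -z) := by
        rw [← Complex.exp_add, hl]; congr 1; ring
      rw [h2]
      ring
  -- the same series in the lower half-plane
  have hr' : Summable fun s => ‖r (-s)‖ * Real.exp (-(2 * Real.pi * s * (-(η + 1)))) := by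
    refine ((Equiv.neg ℝ).summable_iff.2 hr).congr fun s => ?_
    simp only [Function.comp, Equiv.neg_apply]
    congr 3
    ring
  have hFr' : ∀ z : ℂ, z.im = -(η + 1) → F z = dirichletSeries (fun s => r (-s)) z := by
    intro z hz
    have h1 := hFr (-z) (by rw [Complex.neg_im, hz, neg_neg])
    simp only [neg_neg] at h1
    rw [h1, dirichletSeries, dirichletSeries, ← (Equiv.neg ℝ).tsum_eq]
    refine tsum_congr fun s => ?_
    rw [Equiv.neg_apply]
    congr 2
    push_cast
    ring
  obtain ⟨B, hB0, hB⟩ := exists_norm_canonicalProduct_mul_exp_le hs hp l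
  -- `F` is bounded on the lines `Im z = ±(η + 1)` by the weighted norms of `q` and of the reflected
  -- `r`, hence on the strip between them.
  have hqr : q = fun s => r (-s) := by
    have hη1 : 0 < η + 1 := by linarith
    set M := max (∑' s, ‖q s‖ * Real.exp (-(2 * Real.pi * s * (η + 1))))
      (∑' s, ‖r (-s)‖ * Real.exp (-(2 * Real.pi * s * (-(η + 1))))) with hM
    refine coeff_eq_of_bounded_on_strip hFd hη1 (M := M) (fun z hz1 hz2 => ?_) hq hr'
      (fun z hz => hFq z hz.ge) hFr'
    refine norm_le_of_norm_le_on_strip_boundary hFd hB0 hB hη1 (fun w hw => ?_) (fun w hw => ?_)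
      hz1 hz2
    · rw [hFq w hw.ge]
      exact (norm_dirichletSeries_le hq hw).trans (le_max_left _ _)
    · rw [hFr' w hw]
      exact (norm_dirichletSeries_le hr' hw).trans (le_max_right _ _)
  have hnn : ∀ σ, ∀ s ∈ AddSubmonoid.closure (Function.support (β σ)), 0 ≤ s := fun σ s h =>
    AddSubmonoid.closure_induction (motive := fun x _ => 0 ≤ x)
      (fun x hx => by by_contra h0; exact hx (hβ0 σ x (not_le.1 h0).le)) le_rfl
      (fun x y _ _ hx hy => add_nonneg hx hy) h
  -- The upper expansion bounds the spectrum below by `ν`; the lower one, now known to have the same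
  -- coefficients, bounds it above by `-ν`.
  have hlow : ∀ s, q s ≠ 0 → ν ≤ s := fun s h => sub_nonneg.1 (hnn _ _ (hqS s h))
  have hup : ∀ s, q s ≠ 0 → s ≤ -ν := fun s h => by
    rw [hqr] at h
    linarith [hnn _ _ (hrS (-s) h)]
  have hbdd : ∀ s, q s ≠ 0 → |s| ≤ |ν| := fun s h => by
    have h1 := hlow s h
    have h2 := hup s h
    have h3 := neg_abs_le ν
    exact abs_le.2 ⟨by linarith, by linarith⟩
  have hqsum : Summable fun s => ‖q s‖ := by
    refine Summable.of_nonneg_of_le (fun s => norm_nonneg _) (fun s => ?_)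
      (hq.mul_right (Real.exp (2 * Real.pi * (|ν| * (η + 1)))))
    rcases eq_or_ne (q s) 0 with h | h
    · simp [h]
    · rw [mul_assoc, ← Real.exp_add]
      refine le_mul_of_one_le_right (norm_nonneg _) (Real.one_le_exp ?_)
      have h1 : s * (η + 1) ≤ |ν| * (η + 1) :=
        mul_le_mul_of_nonneg_right ((le_abs_self s).trans (hbdd s h)) (by linarith)
      nlinarith
  -- Both sides are entire, so their equality above height `η + 1` extends to the whole plane.
  have heq : F = dirichletSeries q := by
    refine AnalyticOnNhd.eq_of_eventuallyEq (z₀ := ((η + 2 : ℝ) : ℂ) * I)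
      (fun z _ => hFd.analyticAt z)
      (fun z _ => (differentiable_dirichletSeries_of_bounded hqsum hbdd).analyticAt z) ?_
    filter_upwards [(Complex.isOpen_im_gt (η + 1)).mem_nhds
      (show η + 1 < (((η + 2 : ℝ) : ℂ) * I).im by
        rw [Complex.im_ofReal_mul, Complex.I_im]; linarith)] with z hz
    exact hFq z (le_of_lt hz)
  refine ⟨q, hqsum, ?_, heq ▸ hasZeroSet_mul_exp hs hp l, fun hloc => ?_⟩
  · exact isBounded_iff_forall_norm_le.2 ⟨|ν|, fun s hs => hbdd s hs⟩
  -- For `s` in the spectrum, `s - ν` lies in the semigroup and is at most `-2ν`.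
  · have hfin := finite_closure_inter_Iic (G := Function.support (β 1))
      (fun γ h => by by_contra h0; exact h (hβ0 1 γ (not_lt.1 h0)))
      (fun R => (hloc _ (isCompact_Icc (a := 0) (b := R))).subset fun γ hγ => ⟨hγ.1, fun h => hγ.2 ?_⟩)
      (-ν - ν)
    · refine (hfin.image fun s => s + ν).subset fun s hs => ⟨s - ν, ⟨hqS s hs, ?_⟩, by simp⟩
      exact sub_le_sub_right (hup s hs) ν
    · simp [hβ, h]
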